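/- Let $M$ be a complete connected Riemannian manifold of dimension $n$, with Riemannian distance $\delta$ and Riemannian norm $|\cdot|_r$ on tangent vectors, and let $\nabla$ be a smooth torsion-free connection on $M$, not necessarily the Levi-Civita connection; geodesics, parallel transport and Hessians are those of $\nabla$. Let $O\subset M$ be open and relatively compact in the domain of a chart $\phi$, and suppose that any two points $x,x'\in\overline O$ are joined by a unique geodesic $[0,1]\to\overline O$, depending smoothly on $(x,x')$; write $\overset{x'}{\underset{x}{\Vert}}$ for parallel transport from $T_xM$ to $T_{x'}M$ along it. Let $\omega\neq\emptyset$ be open and relatively compact in $O$, with $\overline\omega=\{x\in O:\chi(x)\le c\}$ for a smooth function $\chi:O\to\mathbb R$ that is convex along geodesics and some $c\in\mathbb R$. Let $p\ge 2$ be real and let $\Psi$ be a function which is smooth and convex (along geodesics of the product connection on $M\times M$) on an open set containing $\overline\omega\times\overline\omega$, which on $\overline\omega\times\overline\omega$ is nonnegative and vanishes exactly on the diagonal, and for which there is a constant $C>0$ with $$\tfrac1C\,\delta(x,x')^p\le\Psi(x,x')\le C\,\delta(x,x')^p\qquad\text{for all }x,x'\in\overline\omega .$$ Let $\overline\Gamma{}^k_{ij}$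 be the Christoffel symbols of the product connection in the chart $(\phi,\phi)$, so that $(\mathrm{Hess}\,\Psi)_{ij}=\partial_{ij}\Psi-\sum_k\overline\Gamma{}^k_{ij}\,\partial_k\Psi$ for $1\le i,j\le 2n$. Let $\tilde A(x,x')$ be the upper left $n\times n$ block of the matrix of $\mathrm{Hess}\,\Psi(x,x')$ in the coordinates $v=(\phi(x)-\phi(x'),\phi(x'))$. Suppose that there are a neighbourhood $O_\Delta\subset\overline\omega\times\overline\omega$ of the diagonal $\{(x,x):x\in\overline\omega\}$, relative to $\overline\omega\times\overline\omega$, and an $\eta>0$ such that, with $|\cdot|$ the Euclidean norm, $${}^t z\,\tilde A(x,x')\,z\ \ge\ \eta\,\delta(x,x')^{p-2}\,|z|^2\qquad\text{for all }(x,x')\in O_\Delta,\ z\in\mathbb R^n .$$ Then there are constants $\alpha,\beta>0$ such that, for all $(x,x')\in O_\Delta$ and all $(z,z')\in T_xM\times T_{x'}M$, $$\mathrm{Hess}\,\Psi(x,x')\big\langle(z,z'),(z,z')\big\rangle\ \ge\ \alpha\,\delta(x,x')^{p-2}\,\Big|\overset{x'}{\underset{x}{\Vert}}z-z'\Big|_r^2-\beta\,\Psi(x,x')\big(|z|_r^2+|z'|_r^2\big).$$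 (Here $0^{p-2}=1$ when $p=2$.) -/

import Mathlib

open Set Filter Topology Bundle
open scoped Manifold ContDiff

noncomputable section

namespace GeodesicHessian

section Connection

variable {n : ℕ} {M : Type*} [TopologicalSpace M] [ChartedSpace (EuclideanSpace ℝ (Fin n)) M]
  [IsManifold (𝓡 n) ∞ M]

/-- The coordinate vector field of the chart `φ` with constant components `v`: at a point `x` of
the chart domain it is the tangent vector `v¹ ∂₁ + ⋯ + vⁿ ∂ₙ`. -/
def coordField (φ : OpenPartialHomeomorph M (EuclideanSpace ℝ (Fin n)))
    (v : EuclideanSpace ℝ (Fin n)) (x : M) : TangentSpace (𝓡 n) x :=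
  (mfderiv (𝓡 n) 𝓘(ℝ, EuclideanSpace ℝ (Fin n)) φ x).inverse v

/-- The components in the chart `φ` of a tangent vector `z` at `x`. -/
def comp (φ : OpenPartialHomeomorph M (EuclideanSpace ℝ (Fin n))) (x : M)
    (z : TangentSpace (𝓡 n) x) : EuclideanSpace ℝ (Fin n) :=
  mfderiv (𝓡 n) 𝓘(ℝ, EuclideanSpace ℝ (Fin n)) φ x z

/-- The Christoffel symbols of the connection in the chart `φ`, as a bilinear map at each point `y`
of the chart's image: `christoffel cov φ y u v = ∑ j k, uʲ vᵏ Γ_{jk}(y)`, that is, the components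
of `∇_u v`, where `u` and `v` are extended with constant components. -/
def christoffel (cov : CovariantDerivative (𝓡 n) (EuclideanSpace ℝ (Fin n))
      (fun x : M => TangentSpace (𝓡 n) x))
    (φ : OpenPartialHomeomorph M (EuclideanSpace ℝ (Fin n)))
    (y u v : EuclideanSpace ℝ (Fin n)) : EuclideanSpace ℝ (Fin n) :=
  comp φ (φ.symm y) (cov (coordField φ v) (φ.symm y) (coordField φ u (φ.symm y)))

/-- The curve `γ`, restricted to the time set `J`, stays in the domain of the chart `φ` and is
a geodesic there: in coordinates `c̈ + Γ(c)(ċ, ċ) = 0`, where `c'` below is the velocity `ċ`. -/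
def IsGeodesicOn (cov : CovariantDerivative (𝓡 n) (EuclideanSpace ℝ (Fin n))
      (fun x : M => TangentSpace (𝓡 n) x))
    (φ : OpenPartialHomeomorph M (EuclideanSpace ℝ (Fin n))) (γ : ℝ → M) (J : Set ℝ) : Prop :=
  MapsTo γ J φ.source ∧
    ∃ c' : ℝ → EuclideanSpace ℝ (Fin n), ∀ t ∈ J,
      HasDerivWithinAt (fun s => φ (γ s)) (c' t) J t ∧
      HasDerivWithinAt c' (-christoffel cov φ (φ (γ t)) (c' t) (c' t)) J t

/-- `w` gives the chart components of a vector field along `γ : [0, 1] → M` which is parallel: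
`ẇ + Γ(c)(ċ, w) = 0`. -/
def IsParallelAlong (cov : CovariantDerivative (𝓡 n) (EuclideanSpace ℝ (Fin n))
      (fun x : M => TangentSpace (𝓡 n) x))
    (φ : OpenPartialHomeomorph M (EuclideanSpace ℝ (Fin n))) (γ : ℝ → M)
    (w : ℝ → EuclideanSpace ℝ (Fin n)) : Prop :=
  ∀ t ∈ Icc (0 : ℝ) 1, HasDerivWithinAt w
    (-christoffel cov φ (φ (γ t)) (derivWithin (fun s => φ (γ s)) (Icc 0 1) t) (w t)) (Icc 0 1) t

open Classical in
/-- Parallel transport of the tangent vector `z` at `x` to the point `x'`, along a curve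
`γ : [0, 1] → M` from `x` to `x'` lying in the domain of the chart `φ`. (The parallel field with
given initial value exists and is unique, by the theory of linear differential equations.) -/
def parallelTransport (cov : CovariantDerivative (𝓡 n) (EuclideanSpace ℝ (Fin n))
      (fun x : M => TangentSpace (𝓡 n) x))
    (φ : OpenPartialHomeomorph M (EuclideanSpace ℝ (Fin n))) (γ : ℝ → M) (x x' : M)
    (z : TangentSpace (𝓡 n) x) : TangentSpace (𝓡 n) x' :=
  if h : ∃ w, IsParallelAlong cov φ γ w ∧ w 0 = comp φ x z then coordField φ (h.choose 1) x' else 0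

/-- `G (x, x', ·) : [0, 1] → K` is the unique geodesic in `K` from `x` to `x'`, for all `x, x'` in
`K`, and `G` is smooth on the closed set `K × K × [0, 1]`, i.e. on an open set containing it. -/
structure IsGeodesicMap (cov : CovariantDerivative (𝓡 n) (EuclideanSpace ℝ (Fin n))
      (fun x : M => TangentSpace (𝓡 n) x))
    (φ : OpenPartialHomeomorph M (EuclideanSpace ℝ (Fin n))) (K : Set M)
    (G : M × M × ℝ → M) : Prop where
  geodesic : ∀ x ∈ K, ∀ x' ∈ K, IsGeodesicOn cov φ (fun t => G (x, x', t)) (Icc 0 1)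
  mapsTo : ∀ x ∈ K, ∀ x' ∈ K, MapsTo (fun t => G (x, x', t)) (Icc 0 1) K
  source : ∀ x ∈ K, ∀ x' ∈ K, G (x, x', 0) = x
  target : ∀ x ∈ K, ∀ x' ∈ K, G (x, x', 1) = x'
  unique : ∀ x ∈ K, ∀ x' ∈ K, ∀ γ : ℝ → M, IsGeodesicOn cov φ γ (Icc 0 1) →
    MapsTo γ (Icc 0 1) K → γ 0 = x → γ 1 = x' → EqOn γ (fun t => G (x, x', t)) (Icc 0 1)
  smooth : ∃ U : Set (M × M × ℝ), IsOpen U ∧ K ×ˢ K ×ˢ Icc (0 : ℝ) 1 ⊆ U ∧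
    ContMDiffOn ((𝓡 n).prod ((𝓡 n).prod 𝓘(ℝ, ℝ))) (𝓡 n) ∞ G U

/-- Convexity along geodesics of a function on a subset `S` of the chart domain. -/
def IsGeodesicallyConvexOn (cov : CovariantDerivative (𝓡 n) (EuclideanSpace ℝ (Fin n))
      (fun x : M => TangentSpace (𝓡 n) x))
    (φ : OpenPartialHomeomorph M (EuclideanSpace ℝ (Fin n))) (S : Set M) (χ : M → ℝ) : Prop :=
  ∀ (a b : ℝ) (γ : ℝ → M), IsGeodesicOn cov φ γ (Icc a b) → MapsTo γ (Icc a b) S →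
    ConvexOn ℝ (Icc a b) (fun t => χ (γ t))

/-- Convexity of a function on a subset `W` of `M × M` (contained in the square of the chart
domain) along the geodesics of the product connection, which are the pairs of geodesics. -/
def IsProdGeodesicallyConvexOn (cov : CovariantDerivative (𝓡 n) (EuclideanSpace ℝ (Fin n))
      (fun x : M => TangentSpace (𝓡 n) x))
    (φ : OpenPartialHomeomorph M (EuclideanSpace ℝ (Fin n))) (W : Set (M × M))
    (Ψ : M × M → ℝ) : Prop :=
  ∀ (a b : ℝ) (γ γ' : ℝ → M), IsGeodesicOn cov φ γ (Icc a b) → IsGeodesicOn cov φ γ' (Icc a b) →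
    MapsTo (fun t => (γ t, γ' t)) (Icc a b) W →
    ConvexOn ℝ (Icc a b) (fun t => Ψ (γ t, γ' t))

/-- The Christoffel symbols of the product connection on `M × M` in the chart `(φ, φ)`. -/
def prodChristoffel (cov : CovariantDerivative (𝓡 n) (EuclideanSpace ℝ (Fin n))
      (fun x : M => TangentSpace (𝓡 n) x))
    (φ : OpenPartialHomeomorph M (EuclideanSpace ℝ (Fin n)))
    (y u v : EuclideanSpace ℝ (Fin n) × EuclideanSpace ℝ (Fin n)) :
    EuclideanSpace ℝ (Fin n) × EuclideanSpace ℝ (Fin n) :=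
  (christoffel cov φ y.1 u.1 v.1, christoffel cov φ y.2 u.2 v.2)

/-- The function `Ψ` read in the chart `(φ, φ)`. -/
def inChart (φ : OpenPartialHomeomorph M (EuclideanSpace ℝ (Fin n))) (Ψ : M × M → ℝ)
    (y : EuclideanSpace ℝ (Fin n) × EuclideanSpace ℝ (Fin n)) : ℝ :=
  Ψ (φ.symm y.1, φ.symm y.2)

/-- The Hessian of `Ψ` at `(x, x')` for the product connection, as a bilinear form in the
components of tangent vectors in the chart `(φ, φ)`; its matrix is
`∂ᵢⱼ Ψ - ∑ₖ Γ̄ᵏᵢⱼ ∂ₖ Ψ`. -/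
def hessCoord (cov : CovariantDerivative (𝓡 n) (EuclideanSpace ℝ (Fin n))
      (fun x : M => TangentSpace (𝓡 n) x))
    (φ : OpenPartialHomeomorph M (EuclideanSpace ℝ (Fin n))) (Ψ : M × M → ℝ) (x x' : M)
    (u v : EuclideanSpace ℝ (Fin n) × EuclideanSpace ℝ (Fin n)) : ℝ :=
  fderiv ℝ (fderiv ℝ (inChart φ Ψ)) (φ x, φ x') u v
    - fderiv ℝ (inChart φ Ψ) (φ x, φ x') (prodChristoffel cov φ (φ x, φ x') u v)

/-- The quadratic form of the Hessian of `Ψ` at `(x, x')` on `T_x M × T_{x'} M`. -/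
def hess (cov : CovariantDerivative (𝓡 n) (EuclideanSpace ℝ (Fin n))
      (fun x : M => TangentSpace (𝓡 n) x))
    (φ : OpenPartialHomeomorph M (EuclideanSpace ℝ (Fin n))) (Ψ : M × M → ℝ) (x x' : M)
    (z : TangentSpace (𝓡 n) x) (z' : TangentSpace (𝓡 n) x') : ℝ :=
  hessCoord cov φ Ψ x x' (comp φ x z, comp φ x' z') (comp φ x z, comp φ x' z')

/-- The Hessian of `Ψ` in the coordinates `v = (φ x - φ x', φ x')` on `M × M`. The vector
with `v`-components `(a, b)` has components `(a + b, b)` in the chart `(φ, φ)`. -/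
def hessV (cov : CovariantDerivative (𝓡 n) (EuclideanSpace ℝ (Fin n))
      (fun x : M => TangentSpace (𝓡 n) x))
    (φ : OpenPartialHomeomorph M (EuclideanSpace ℝ (Fin n))) (Ψ : M × M → ℝ) (x x' : M)
    (u v : EuclideanSpace ℝ (Fin n) × EuclideanSpace ℝ (Fin n)) : ℝ :=
  hessCoord cov φ Ψ x x' (u.1 + u.2, u.2) (v.1 + v.2, v.2)

/-- The quadratic form of the upper left `n × n` block `Ã` of the Hessian in `v`-coordinates. -/
def blockA (cov : CovariantDerivative (𝓡 n) (EuclideanSpace ℝ (Fin n))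
      (fun x : M => TangentSpace (𝓡 n) x))
    (φ : OpenPartialHomeomorph M (EuclideanSpace ℝ (Fin n))) (Ψ : M × M → ℝ) (x x' : M)
    (a : EuclideanSpace ℝ (Fin n)) : ℝ :=
  hessV cov φ Ψ x x' (a, 0) (a, 0)

end Connection

end GeodesicHessian

end

noncomputable section

/-! Write b for the chart components of z' and a + b for those of z. The vector (z, z') then splits
as (a, 0) + (b, b), a transversal part plus a part along the diagonal. The term of the Hessian
quadratic in a is the block Ã, bounded below by η δ^(p-2) |a|²; everything else has to be shown
small.

Since Ψ is smooth and O(δ^p), its transversal derivatives of order less than m = ⌈p⌉ vanish on the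
diagonal. Differentiating along the diagonal does not lower this order of vanishing, and one
transversal derivative lowers it by one (`exists_diagonal_estimates`). So the mixed terms are
O(δ^(p-1) |a| |b|) and the terms quadratic in b are O(δ^p |b|²). The Christoffel terms obey the same
bounds, because the symbols at x and x' differ by O(δ) and the pair (Γ(b,b), Γ'(b,b)) is therefore
diagonal up to O(δ) (`exists_le_hessCoord_near_diagonal`). Completing the square leaves (η/2)
δ^(p-2) |a|² minus a multiple of δ^p |b|², and δ^p ≤ C Ψ.

Parallel transport solves a linear equation whose coefficient is Γ contracted with the velocity of
the geodesic. That velocity vanishes when x = x', hence is O(δ), so the transported z minus z' has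
components a + O(δ |z|), and |a| may be exchanged for the norm of this difference at the cost of
another δ^p |z|² (`IsGeodesicMap.exists_norm_parallelTransport_sub_le`).

By compactness these estimates are uniform for δ < ε. For δ ≥ ε, Ψ is bounded below by ε^p / C, and
the bounded Hessian and transport are absorbed in β Ψ. -/

namespace GeodesicHessian


/-! ### Order of vanishing in one real variable, with parameters -/

section Vanishing

/-- A smooth curve that is `O(|s|^p)` at `0` has vanishing derivatives of order less than `p`. -/
theorem iteratedDeriv_eq_zero_of_isBigO {F : Type*} [NormedAddCommGroup F] [NormedSpace ℝ F]
    {h : ℝ → F} (hh : ContDiffAt ℝ ∞ h 0) {p : ℝ}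
    (hO : h =O[𝓝 0] fun s : ℝ => |s| ^ p) (j : ℕ) (hj : (j : ℝ) < p) :
    iteratedDeriv j h 0 = 0 := by
  induction j using Nat.strong_induction_on with
  | _ j ih =>
  obtain ⟨r, hr, hcd⟩ : ∃ r > 0, ContDiffOn ℝ j h (Metric.ball (0 : ℝ) r) := by
    obtain ⟨u, hu, h1⟩ := hh.contDiffOn (m := j) (by exact_mod_cast le_top) (by simp)
    obtain ⟨r, hr, h2⟩ := Metric.mem_nhds_iff.1 hu
    exact ⟨r, hr, h1.mono h2⟩
  have h0 : (0 : ℝ) ∈ Metric.ball (0 : ℝ) r := Metric.mem_ball_self hr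
  have ht := taylor_isLittleO (convex_ball 0 r) h0 hcd
  rw [Metric.isOpen_ball.nhdsWithin_eq h0] at ht
  -- By induction only the top term of the Taylor polynomial survives.
  have hval : ∀ x : ℝ, taylorWithinEval h j (Metric.ball (0 : ℝ) r) 0 x
      = ((j.factorial : ℝ)⁻¹ * x ^ j) • iteratedDeriv j h 0 := by
    intro x
    rw [taylor_within_apply, Finset.sum_eq_single j]
    · rw [iteratedDerivWithin_of_isOpen Metric.isOpen_ball h0]; simp
    · intro i hi hij
      have : i < j := by rw [Finset.mem_range] at hi; omega
      rw [iteratedDerivWithin_of_isOpen Metric.isOpen_ball h0,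
        ih i this (lt_trans (by exact_mod_cast this) hj), smul_zero]
    · simp
  have hpj : (fun s : ℝ => |s| ^ p) =o[𝓝 0] fun s : ℝ => s ^ j := by
    have : (fun s : ℝ => |s| ^ (p - j) * s ^ j) =o[𝓝 0] fun s : ℝ => 1 * s ^ j := by
      refine Asymptotics.IsLittleO.mul_isBigO ?_ (Asymptotics.isBigO_refl _ _)
      rw [Asymptotics.isLittleO_one_iff]
      have hc : Continuous fun s : ℝ => |s| ^ (p - j) :=
        continuous_abs.rpow_const fun _ => Or.inr (by linarith)
      simpa [Real.zero_rpow (by linarith : p - (j : ℝ) ≠ 0)] using hc.tendsto 0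
    refine (Asymptotics.isLittleO_norm_right.1 ?_)
    refine (this.norm_left.norm_right).congr_left ?_ |>.congr_right ?_ |>.of_norm_left
    · intro s
      have e : |s| ^ p = |s| ^ (p - j) * |s| ^ j := by
        rcases eq_or_ne s 0 with rfl | hs
        · have : p ≠ 0 := by have := j.cast_nonneg (α := ℝ); linarith
          simp [Real.zero_rpow this, Real.zero_rpow (by linarith : p - (j : ℝ) ≠ 0)]
        · rw [← Real.rpow_natCast, ← Real.rpow_add (abs_pos.2 hs)]; ring_nf
      simp [e]
    · intro s; simp
  have key := (hO.trans_isLittleO hpj).sub ((ht.congr_right (g₂ := fun s : ℝ => s ^ j) (by simp)))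
  -- Both h and the Taylor remainder are o(s^j), hence so is the surviving monomial, which forces
  -- its coefficient to vanish.
  have key2 : (fun s : ℝ => ((j.factorial : ℝ)⁻¹ * s ^ j) • iteratedDeriv j h 0)
      =o[𝓝 0] fun s : ℝ => s ^ j := by
    refine key.congr_left fun s => ?_
    rw [hval]; abel
  by_contra hne
  set c := ‖iteratedDeriv j h 0‖ with hc
  have hcpos : 0 < c := norm_pos_iff.2 hne
  have hε : 0 < (j.factorial : ℝ)⁻¹ * c / 2 := by positivity
  have hev := key2.def hε
  obtain ⟨δ, hδ, hball⟩ := Metric.eventually_nhds_iff.1 hev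
  have := hball (y := δ / 2) (by simp [abs_of_pos, hδ])
  rw [norm_smul, norm_mul, norm_inv, norm_pow] at this
  simp only [Real.norm_natCast, ← hc] at this
  have hpow : 0 < ‖δ / 2‖ ^ j := pow_pos (norm_pos_iff.2 (by positivity)) j
  have hf : 0 < (j.factorial : ℝ)⁻¹ := by positivity
  nlinarith [mul_pos (mul_pos hf hpow) hcpos]

variable {X : Type*} [NormedAddCommGroup X] [NormedSpace ℝ X]

/-- The partial derivatives of `g` of order less than `k` in the first variable vanish on
`{0} × D`. -/
def VanishesToOrder (D : Set X) : ∀ (_ : ℕ) {F : Type*} [NormedAddCommGroup F] [NormedSpace ℝ F]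
    (_ : ℝ × X → F), Prop
  | 0, _, _, _, _ => True
  | k + 1, _, _, _, g => (∀ w ∈ D, g (0, w) = 0) ∧
      VanishesToOrder D k fun x => fderiv ℝ g x (1, 0)

variable {F : Type*} [NormedAddCommGroup F] [NormedSpace ℝ F] {D : Set X} {V : Set (ℝ × X)}

theorem contDiffOn_fderiv_apply {Y : Type*} [NormedAddCommGroup Y] [NormedSpace ℝ Y]
    {V : Set Y} {g : Y → F} (hV : IsOpen V) (hg : ContDiffOn ℝ ∞ g V) (v : Y) :
    ContDiffOn ℝ ∞ (fun x => fderiv ℝ g x v) V :=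
  (hg.fderiv_of_isOpen hV (by simp)).clm_apply contDiffOn_const

theorem VanishesToOrder.congr {k : ℕ} (hV : IsOpen V) (hDV : ∀ w ∈ D, ((0 : ℝ), w) ∈ V)
    {g g' : ℝ × X → F} (h : EqOn g g' V) (hg : VanishesToOrder D k g) :
    VanishesToOrder D k g' := by
  induction k generalizing g g' with
  | zero => trivial
  | succ k ih =>
    refine ⟨fun w hw => by rw [← h (hDV w hw)]; exact hg.1 w hw, ih ?_ hg.2⟩
    intro x hx
    have : g =ᶠ[𝓝 x] g' := h.eventuallyEq_of_mem (hV.mem_nhds hx)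
    simp only [this.fderiv_eq]

/-- The recursion unwinds into derivatives of the slices s ↦ g (s, w), because the partial
derivative in s restricted to a slice is the derivative of the slice. -/
theorem vanishesToOrder_of_iteratedDeriv {k : ℕ} (hV : IsOpen V)
    (hDV : ∀ w ∈ D, ((0 : ℝ), w) ∈ V) {g : ℝ × X → F} (hg : ContDiffOn ℝ ∞ g V)
    (h : ∀ w ∈ D, ∀ j < k, iteratedDeriv j (fun s => g (s, w)) 0 = 0) :
    VanishesToOrder D k g := by
  induction k generalizing g with
  | zero => trivial
  | succ k ih =>
    refine ⟨fun w hw => by simpa using h w hw 0 (by omega),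
      ih (contDiffOn_fderiv_apply hV hg _) fun w hw j hj => ?_⟩
    rw [← h w hw (j + 1) (by omega), iteratedDeriv_succ']
    refine Filter.EventuallyEq.iteratedDeriv_eq _ ?_
    have hc : ContinuousAt (fun s : ℝ => (s, w)) 0 := by fun_prop
    filter_upwards [hc.preimage_mem_nhds (hV.mem_nhds (hDV w hw))] with s hs
    have hd : HasFDerivAt g (fderiv ℝ g (s, w)) (s, w) :=
      ((hg.contDiffAt (hV.mem_nhds hs)).differentiableAt (by simp)).hasFDerivAt
    have hl : HasDerivAt (fun s : ℝ => (s, w)) ((1 : ℝ), (0 : X)) s :=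
      (hasDerivAt_id s).prodMk (hasDerivAt_const s w)
    exact (hd.comp_hasDerivAt s hl).deriv.symm

/-- Partial derivatives in the second variable preserve the order of vanishing. -/
theorem VanishesToOrder.partial_snd {k : ℕ} (hD : IsOpen D) (hV : IsOpen V)
    (hDV : ∀ w ∈ D, ((0 : ℝ), w) ∈ V) {g : ℝ × X → F} (hg : ContDiffOn ℝ ∞ g V)
    (h : VanishesToOrder D k g) :
    VanishesToOrder D k fun x => (fderiv ℝ g x).comp (ContinuousLinearMap.inr ℝ ℝ X) := by
  induction k generalizing g with
  | zero => trivial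
  | succ k ih =>
    have hdiff : ∀ x ∈ V, DifferentiableAt ℝ g x := fun x hx =>
      (hg.contDiffAt (hV.mem_nhds hx)).differentiableAt (by simp)
    refine ⟨fun w hw => ?_, ?_⟩
    -- On the slice s = 0 the function is zero on the open set D, so its derivative in w is zero
    -- there.
    · have h1 : HasFDerivAt (fun w' : X => g ((0 : ℝ), w'))
          ((fderiv ℝ g (0, w)).comp (ContinuousLinearMap.inr ℝ ℝ X)) w :=
        (hdiff _ (hDV w hw)).hasFDerivAt.comp w (hasFDerivAt_prodMk_right 0 w)
      have h2 : (fun w' : X => g ((0 : ℝ), w')) =ᶠ[𝓝 w] fun _ => 0 := by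
        filter_upwards [hD.mem_nhds hw] with w' hw' using h.1 w' hw'
      exact h1.unique ((hasFDerivAt_const (0 : F) w).congr_of_eventuallyEq h2)
    -- Symmetry of the second derivative exchanges ∂_s with the derivative in w, so the induction
    -- hypothesis applies to ∂_s g.
    · refine (ih (contDiffOn_fderiv_apply hV hg _) h.2).congr hV hDV fun x hx => ?_
      have h2 : DifferentiableAt ℝ (fderiv ℝ g) x :=
        ((hg.fderiv_of_isOpen hV (m := ∞) (by simp)).contDiffAt
          (hV.mem_nhds hx)).differentiableAt (by simp)
      have hsymm : IsSymmSndFDerivAt ℝ g x :=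
        (hg.contDiffAt (hV.mem_nhds hx)).isSymmSndFDerivAt
          (by simpa using ENat.LEInfty.out)
      ext v
      have e1 : fderiv ℝ (fun x => fderiv ℝ g x ((1 : ℝ), (0 : X))) x
          = (fderiv ℝ (fderiv ℝ g) x).flip (1, 0) := by
        ext v <;> simp [fderiv_clm_apply h2 (differentiableAt_const _)]
      have e2 : fderiv ℝ (fun x => (fderiv ℝ g x).comp (ContinuousLinearMap.inr ℝ ℝ X)) x (1, 0)
          = (fderiv ℝ (fderiv ℝ g) x (1, 0)).comp (ContinuousLinearMap.inr ℝ ℝ X) := by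
        rw [fderiv_clm_comp h2 (differentiableAt_const _)]
        simp
      simp only [e1, e2, ContinuousLinearMap.comp_apply, ContinuousLinearMap.flip_apply]
      exact hsymm _ _

/-- A smooth function vanishing to order `k` at `s = 0` is locally `O(s^k)`. -/
theorem VanishesToOrder.exists_bound {k : ℕ} (hV : IsOpen V)
    {g : ℝ × X → F} (hg : ContDiffOn ℝ ∞ g V) (h : VanishesToOrder D k g)
    {w₀ : X} (hw₀ : ((0 : ℝ), w₀) ∈ V) :
    ∃ C, 0 ≤ C ∧ ∀ᶠ x in 𝓝 ((0 : ℝ), w₀), x.2 ∈ closure D → ‖g x‖ ≤ C * |x.1| ^ k := by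
  induction k generalizing g with
  | zero =>
    have hc : ContinuousAt g (0, w₀) := (hg.contDiffAt (hV.mem_nhds hw₀)).continuousAt
    refine ⟨‖g (0, w₀)‖ + 1, by positivity, ?_⟩
    filter_upwards [hc.norm.eventually_lt_const (lt_add_one _)] with x hx _
    simpa using hx.le
  | succ k ih =>
    -- The bound on ∂_s g is integrated from s = 0. The mean value inequality on the ball of radius
    -- |x.1| gains exactly one factor |x.1|, so C is unchanged.
    obtain ⟨C, hC, hev⟩ := ih (contDiffOn_fderiv_apply hV hg _) h.2
    refine ⟨C, hC, ?_⟩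
    obtain ⟨r, hr, hball⟩ := Metric.eventually_nhds_iff_ball.1
      (hev.and (hV.mem_nhds hw₀ : ∀ᶠ x in 𝓝 ((0 : ℝ), w₀), x ∈ V))
    filter_upwards [Metric.ball_mem_nhds _ hr] with x hx hxD
    rw [← ball_prod_same, mem_prod] at hx
    have hmem : ∀ s : ℝ, |s| ≤ |x.1| → (s, x.2) ∈ Metric.ball ((0 : ℝ), w₀) r := by
      intro s hs
      rw [← ball_prod_same]
      refine ⟨?_, hx.2⟩
      have := hx.1
      simp only [Metric.mem_ball, dist_zero_right, Real.norm_eq_abs] at this ⊢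
      exact hs.trans_lt this
    -- Vanishing is known over D only and passes to the closure by continuity; the closure is needed
    -- to reach boundary points.
    have h0 : g (0, x.2) = 0 := by
      have hx0 : ((0 : ℝ), x.2) ∈ V := (hball _ (hmem 0 (by simp))).2
      have hcont : ContinuousAt (fun w => g ((0 : ℝ), w)) x.2 :=
        ((hg.contDiffAt (hV.mem_nhds hx0)).continuousAt).comp (f := fun w => ((0 : ℝ), w))
          (by fun_prop)
      have hfreq := mem_closure_iff_frequently.1 hxD
      by_contra hne
      have := hcont.eventually_ne hne
      obtain ⟨w, hw1, hw2⟩ := (hfreq.and_eventually this).exists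
      exact hw2 (h.1 w hw1)
    have hderiv : ∀ s ∈ Metric.closedBall (0 : ℝ) |x.1|,
        HasDerivWithinAt (fun s => g (s, x.2)) (fderiv ℝ g (s, x.2) (1, 0))
          (Metric.closedBall (0 : ℝ) |x.1|) s := by
      intro s hs
      have hs' := hball _ (hmem s (by simpa using hs))
      have hd : HasFDerivAt g (fderiv ℝ g (s, x.2)) (s, x.2) :=
        ((hg.contDiffAt (hV.mem_nhds hs'.2)).differentiableAt (by simp)).hasFDerivAt
      exact (hd.comp_hasDerivAt s ((hasDerivAt_id s).prodMk
        (hasDerivAt_const s x.2))).hasDerivWithinAt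
    have hb : ∀ s ∈ Metric.closedBall (0 : ℝ) |x.1|,
        ‖fderiv ℝ g (s, x.2) (1, 0)‖ ≤ C * |x.1| ^ k := by
      intro s hs
      have hs1 : |s| ≤ |x.1| := by simpa using hs
      refine ((hball _ (hmem s hs1)).1 hxD).trans ?_
      gcongr
    have := (convex_closedBall (0 : ℝ) |x.1|).norm_image_sub_le_of_norm_hasDerivWithin_le
      hderiv hb (Metric.mem_closedBall_self (abs_nonneg _)) (by simp : x.1 ∈ _)
    simpa [h0, pow_succ, mul_assoc] using this

end Vanishing


/-! ### Derivatives near the diagonal of a function that is O(‖y' - y‖ ^ p) -/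

section DiagonalEstimates

variable {E : Type*} [NormedAddCommGroup E] [NormedSpace ℝ E]

/-- The linear map `(a, b) ↦ (s a + b, b)`. -/
def dilatedShear (s : ℝ) : E × E →L[ℝ] E × E :=
  (s • ContinuousLinearMap.fst ℝ E E + ContinuousLinearMap.snd ℝ E E).prod
    (ContinuousLinearMap.snd ℝ E E)

@[simp] theorem dilatedShear_apply (s : ℝ) (w : E × E) :
    dilatedShear s w = (s • w.1 + w.2, w.2) := rfl

theorem contDiff_dilatedShear : ContDiff ℝ ∞ fun x : ℝ × E × E => dilatedShear x.1 x.2 := by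
  simp only [dilatedShear_apply]
  fun_prop

variable {f : E × E → ℝ} {V : Set (E × E)}

theorem fderiv_comp_dilatedShear (hV : IsOpen V) (hf : ContDiffOn ℝ ∞ f V) {x : ℝ × E × E}
    (hx : dilatedShear x.1 x.2 ∈ V) :
    (fderiv ℝ (fun x : ℝ × E × E => f (dilatedShear x.1 x.2)) x).comp
      (ContinuousLinearMap.inr ℝ ℝ (E × E))
      = (fderiv ℝ f (dilatedShear x.1 x.2)).comp (dilatedShear x.1) := by
  have hd : HasFDerivAt f (fderiv ℝ f (dilatedShear x.1 x.2)) (dilatedShear x.1 x.2) :=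
    ((hf.contDiffAt (hV.mem_nhds hx)).differentiableAt (by simp)).hasFDerivAt
  have h1 : HasFDerivAt (fun w => f (dilatedShear x.1 w))
      ((fderiv ℝ f (dilatedShear x.1 x.2)).comp (dilatedShear x.1)) x.2 :=
    hd.comp x.2 (dilatedShear (E := E) x.1).hasFDerivAt
  have h2 : DifferentiableAt ℝ (fun x : ℝ × E × E => f (dilatedShear x.1 x.2)) (x.1, x.2) :=
    hd.differentiableAt.comp (x.1, x.2)
      (contDiff_dilatedShear.contDiffAt.differentiableAt (by simp))
  exact (h2.hasFDerivAt.comp x.2 (hasFDerivAt_prodMk_right x.1 x.2)).unique h1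

/-- For fixed s the shear is linear, so the chain rule produces no term with a second derivative of
the shear. -/
theorem fderiv_fderiv_comp_dilatedShear (hV : IsOpen V) (hf : ContDiffOn ℝ ∞ f V)
    {x : ℝ × E × E} (hx : dilatedShear x.1 x.2 ∈ V) (v v' : E × E) :
    fderiv ℝ (fun x => (fderiv ℝ (fun x : ℝ × E × E => f (dilatedShear x.1 x.2)) x).comp
      (ContinuousLinearMap.inr ℝ ℝ (E × E))) x (0, v) v'
      = fderiv ℝ (fderiv ℝ f) (dilatedShear x.1 x.2) (dilatedShear x.1 v)
        (dilatedShear x.1 v') := by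
  have hopen : IsOpen ((fun x : ℝ × E × E => dilatedShear x.1 x.2) ⁻¹' V) :=
    hV.preimage contDiff_dilatedShear.continuous
  have hev : (fun x => (fderiv ℝ (fun x : ℝ × E × E => f (dilatedShear x.1 x.2)) x).comp
      (ContinuousLinearMap.inr ℝ ℝ (E × E))) =ᶠ[𝓝 x]
      fun x => (fderiv ℝ f (dilatedShear x.1 x.2)).comp (dilatedShear x.1) := by
    filter_upwards [hopen.mem_nhds hx] with z hz using fderiv_comp_dilatedShear hV hf hz
  have hd : HasFDerivAt (fderiv ℝ f) (fderiv ℝ (fderiv ℝ f) (dilatedShear x.1 x.2))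
      (dilatedShear x.1 x.2) :=
    (((hf.fderiv_of_isOpen hV (m := ∞) (by simp)).contDiffAt
      (hV.mem_nhds hx)).differentiableAt (by simp)).hasFDerivAt
  have hS : DifferentiableAt ℝ (fun x : ℝ × E × E => (dilatedShear x.1 : E × E →L[ℝ] E × E)) x := by
    have : (fun x : ℝ × E × E => (dilatedShear x.1 : E × E →L[ℝ] E × E)) = fun x =>
        x.1 • (ContinuousLinearMap.fst ℝ E E).prod 0 + (dilatedShear 0 : E × E →L[ℝ] E × E) := by
      funext x; ext <;> simp [dilatedShear]
    rw [this]
    fun_prop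
  have h1 : HasFDerivAt (fun w => (fderiv ℝ f (dilatedShear x.1 w)).comp (dilatedShear x.1))
      (((ContinuousLinearMap.compL ℝ (E × E) (E × E) ℝ).flip (dilatedShear x.1)).comp
        ((fderiv ℝ (fderiv ℝ f) (dilatedShear x.1 x.2)).comp (dilatedShear x.1))) x.2 :=
    ((ContinuousLinearMap.compL ℝ (E × E) (E × E) ℝ).flip (dilatedShear x.1)).hasFDerivAt.comp x.2
      (hd.comp x.2 (dilatedShear (E := E) x.1).hasFDerivAt)
  have h2 : DifferentiableAt ℝ
      (fun x : ℝ × E × E => (fderiv ℝ f (dilatedShear x.1 x.2)).comp (dilatedShear x.1)) x :=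
    (hd.differentiableAt.comp x
      (contDiff_dilatedShear.contDiffAt.differentiableAt (by simp))).clm_comp hS
  have h3 := ((show HasFDerivAt _ _ (x.1, x.2) from h2.hasFDerivAt).comp x.2
    (hasFDerivAt_prodMk_right x.1 x.2)).unique h1
  rw [hev.fderiv_eq]
  exact congrArg (fun T => T v v') h3

/-- Estimates for the derivatives, near the diagonal, of a smooth function which is
`O(‖y' - y‖ ^ p)` there: the derivatives in the direction of the diagonal do not lower
the order of vanishing. -/
theorem exists_diagonal_estimates {D : Set E} (hD : IsOpen D) (hV : IsOpen V)
    (hf : ContDiffOn ℝ ∞ f V) (hDV : ∀ y ∈ D, (y, y) ∈ V) {p : ℝ} {m : ℕ} (hm : (m : ℝ) < p + 1)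
    (hm1 : 1 ≤ m)
    (hO : ∀ y ∈ D, (fun u => f (y + u, y)) =O[𝓝 0] fun u => ‖u‖ ^ p) {y₀ : E}
    (hy₀ : (y₀, y₀) ∈ V) :
    ∃ C, 0 ≤ C ∧ ∀ᶠ q in 𝓝 (y₀, y₀), q.2 ∈ closure D → ∀ a b : E,
      |fderiv ℝ (fderiv ℝ f) q (a, 0) (b, b)| ≤ C * ‖q.1 - q.2‖ ^ (m - 1) * (‖a‖ * ‖b‖) ∧
      |fderiv ℝ (fderiv ℝ f) q (b, b) (a, 0)| ≤ C * ‖q.1 - q.2‖ ^ (m - 1) * (‖a‖ * ‖b‖) ∧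
      |fderiv ℝ (fderiv ℝ f) q (b, b) (b, b)| ≤ C * ‖q.1 - q.2‖ ^ m * ‖b‖ ^ 2 ∧
      |fderiv ℝ f q (a, 0)| ≤ C * ‖q.1 - q.2‖ ^ (m - 1) * ‖a‖ ∧
      |fderiv ℝ f q (b, b)| ≤ C * ‖q.1 - q.2‖ ^ m * ‖b‖ := by
  -- In g (s, (u, y)) = f (s u + y, y) the transversal order of vanishing becomes an order in s,
  -- which derivatives in (u, y) preserve. A derivative in u is s times a transversal derivative of
  -- f; a derivative in y is one along the diagonal.
  set g : ℝ × E × E → ℝ := fun x => f (dilatedShear x.1 x.2) with hg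
  set V' : Set (ℝ × E × E) := (fun x : ℝ × E × E => dilatedShear x.1 x.2) ⁻¹' V with hV'def
  have hV' : IsOpen V' := hV.preimage contDiff_dilatedShear.continuous
  have hgV : ContDiffOn ℝ ∞ g V' := hf.comp contDiff_dilatedShear.contDiffOn fun x hx => hx
  set D' : Set (E × E) := univ ×ˢ D with hD'def
  have hD' : IsOpen D' := isOpen_univ.prod hD
  have hDV' : ∀ w ∈ D', ((0 : ℝ), w) ∈ V' := fun w hw => by
    simpa [V'] using hDV w.2 hw.2
  have hclD : ∀ w : E × E, w.2 ∈ closure D → w ∈ closure D' := fun w hw => by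
    simpa [D', closure_prod_eq] using hw
  have hvan : VanishesToOrder D' m g := by
    refine vanishesToOrder_of_iteratedDeriv hV' hDV' hgV fun w hw j hj => ?_
    refine iteratedDeriv_eq_zero_of_isBigO (p := p) ?_ ?_ j ?_
    · exact (hgV.contDiffAt (hV'.mem_nhds (hDV' w hw))).comp (0 : ℝ)
        (f := fun s : ℝ => (s, w)) (by fun_prop)
    · have ht : Tendsto (fun s : ℝ => s • w.1) (𝓝 0) (𝓝 0) := by
        have : Continuous fun s : ℝ => s • w.1 := by fun_prop
        simpa using this.tendsto 0
      refine ((hO w.2 hw.2).comp_tendsto ht).congr_left (f₂ := fun s => g (s, w))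
        (fun s => by simp [g, add_comm]) |>.trans ?_
      refine Asymptotics.IsBigO.of_bound (‖w.1‖ ^ p) (Eventually.of_forall fun s => ?_)
      simp only [Function.comp_apply, norm_smul, Real.norm_eq_abs]
      rw [Real.mul_rpow (abs_nonneg _) (norm_nonneg _), abs_mul, mul_comm,
        abs_of_nonneg (Real.rpow_nonneg (norm_nonneg w.1) p)]
    · have : (j : ℝ) + 1 ≤ m := by exact_mod_cast hj
      linarith
  set G₁ := fun x => (fderiv ℝ g x).comp (ContinuousLinearMap.inr ℝ ℝ (E × E)) with hG₁
  have hG₁V : ContDiffOn ℝ ∞ G₁ V' :=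
    (hgV.fderiv_of_isOpen hV' (by simp)).clm_comp contDiffOn_const
  have hvan₁ : VanishesToOrder D' m G₁ := hvan.partial_snd hD' hV' hDV' hgV
  set G₂ := fun x => (fderiv ℝ G₁ x).comp (ContinuousLinearMap.inr ℝ ℝ (E × E)) with hG₂
  have hG₂V : ContDiffOn ℝ ∞ G₂ V' :=
    (hG₁V.fderiv_of_isOpen hV' (by simp)).clm_comp contDiffOn_const
  have hvan₂ : VanishesToOrder D' m G₂ := hvan₁.partial_snd hD' hV' hDV' hG₁V
  have hbase : ((0 : ℝ), ((0 : E), y₀)) ∈ V' := by simpa [V'] using hy₀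
  obtain ⟨C₁, hC₁, hev₁⟩ := hvan₁.exists_bound hV' hG₁V hbase
  obtain ⟨C₂, hC₂, hev₂⟩ := hvan₂.exists_bound hV' hG₂V hbase
  obtain ⟨r, hr, hball⟩ := Metric.eventually_nhds_iff_ball.1 (hev₁.and hev₂)
  set K := C₁ + C₂ with hK
  have hK0 : 0 ≤ K := by positivity
  refine ⟨K * (2 / r) ^ (m - 1) + K * (2 / r) ^ m, by positivity, ?_⟩
  have hsmall : ∀ᶠ q : E × E in 𝓝 (y₀, y₀), ‖q.1 - q.2‖ < r / 2 * r := by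
    have hc : Continuous fun q : E × E => ‖q.1 - q.2‖ := by fun_prop
    exact hc.continuousAt.eventually_lt_const (by simpa using by positivity)
  have hsmall₂ : ∀ᶠ q : E × E in 𝓝 (y₀, y₀), q.2 ∈ Metric.ball y₀ r :=
    continuous_snd.continuousAt.eventually (Metric.ball_mem_nhds _ hr)
  filter_upwards [hV.mem_nhds hy₀, hsmall, hsmall₂] with q hqV hq hq₂ hqD a b
  -- The scale s is left free. Each transversal argument (a, 0) is s⁻¹ times a sheared vector, which
  -- costs one power of s; diagonal arguments (b, b) cost none.
  have core : ∀ s : ℝ, 0 < s → s < r → ‖q.1 - q.2‖ < r * s →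
      |fderiv ℝ (fderiv ℝ f) q (a, 0) (b, b)| ≤ K * (‖a‖ * ‖b‖) * s ^ (m - 1) ∧
      |fderiv ℝ (fderiv ℝ f) q (b, b) (a, 0)| ≤ K * (‖a‖ * ‖b‖) * s ^ (m - 1) ∧
      |fderiv ℝ (fderiv ℝ f) q (b, b) (b, b)| ≤ K * ‖b‖ ^ 2 * s ^ m ∧
      |fderiv ℝ f q (a, 0)| ≤ K * ‖a‖ * s ^ (m - 1) ∧
      |fderiv ℝ f q (b, b)| ≤ K * ‖b‖ * s ^ m := by
    intro s hs hsr hus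
    set x : ℝ × E × E := (s, s⁻¹ • (q.1 - q.2), q.2) with hx
    have hxq : dilatedShear x.1 x.2 = q := by
      simp [x, smul_smul, hs.ne']
    have hxV : dilatedShear x.1 x.2 ∈ V := by rw [hxq]; exact hqV
    have hxb : x ∈ Metric.ball ((0 : ℝ), ((0 : E), y₀)) r := by
      rw [← ball_prod_same, ← ball_prod_same]
      refine ⟨by simpa [x, abs_of_pos hs] using hsr, ?_, hq₂⟩
      simp only [x, Metric.mem_ball, dist_zero_right, norm_smul, norm_inv, Real.norm_eq_abs,
        abs_of_pos hs]
      rw [inv_mul_lt_iff₀ hs]; linarith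
    have hxD : x.2 ∈ closure D' := hclD _ hqD
    have b₁ : ‖G₁ x‖ ≤ K * s ^ m := by
      refine ((hball x hxb).1 hxD).trans ?_
      rw [abs_of_pos (show (0 : ℝ) < x.1 from hs)]
      exact mul_le_mul_of_nonneg_right (by linarith) (pow_nonneg hs.le _)
    have b₂ : ‖G₂ x‖ ≤ K * s ^ m := by
      refine ((hball x hxb).2 hxD).trans ?_
      rw [abs_of_pos (show (0 : ℝ) < x.1 from hs)]
      exact mul_le_mul_of_nonneg_right (by linarith) (pow_nonneg hs.le _)
    have e₁ : ∀ v, |fderiv ℝ f q (dilatedShear s v)| ≤ K * s ^ m * ‖v‖ := fun v => by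
      have : G₁ x v = fderiv ℝ f q (dilatedShear s v) := by
        rw [hG₁]; simp only [hg]
        rw [fderiv_comp_dilatedShear hV hf hxV, hxq]; rfl
      rw [← this, ← Real.norm_eq_abs]
      exact (G₁ x).le_of_opNorm_le b₁ v
    have e₂ : ∀ v v', |fderiv ℝ (fderiv ℝ f) q (dilatedShear s v) (dilatedShear s v')|
        ≤ K * s ^ m * ‖v‖ * ‖v'‖ := fun v v' => by
      have : G₂ x v v' = fderiv ℝ (fderiv ℝ f) q (dilatedShear s v) (dilatedShear s v') := by
        have := fderiv_fderiv_comp_dilatedShear hV hf hxV v v'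
        rw [hxq] at this
        exact this
      rw [← this, ← Real.norm_eq_abs]
      exact ((G₂ x v).le_of_opNorm_le ((G₂ x).le_of_opNorm_le b₂ v) v')
    have ha : (dilatedShear s (a, 0) : E × E) = s • (a, 0) := by simp
    have hb : (dilatedShear s (0, b) : E × E) = (b, b) := by simp
    have na : ‖((a, 0) : E × E)‖ = ‖a‖ := by simp
    have nb : ‖((0, b) : E × E)‖ = ‖b‖ := by simp
    have hpow : s ^ m = s * s ^ (m - 1) := by
      rw [← pow_succ']; congr 1; omega
    have hcancel : ∀ A B : ℝ, s * A ≤ s * B → A ≤ B := fun A B h => le_of_mul_le_mul_left h hs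
    refine ⟨hcancel _ _ ?_, hcancel _ _ ?_, ?_, hcancel _ _ ?_, ?_⟩
    · have := e₂ (a, 0) (0, b)
      rw [ha, hb, na, nb, map_smul, _root_.smul_apply, smul_eq_mul, abs_mul,
        abs_of_pos hs] at this
      rw [hpow] at this; linarith
    · have := e₂ (0, b) (a, 0)
      rw [ha, hb, na, nb, map_smul, smul_eq_mul, abs_mul, abs_of_pos hs] at this
      rw [hpow] at this; linarith
    · have := e₂ (0, b) (0, b)
      rw [hb, nb] at this
      linarith
    · have := e₁ (a, 0)
      rw [ha, na, map_smul, smul_eq_mul, abs_mul, abs_of_pos hs] at this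
      rw [hpow] at this; linarith
    · have := e₁ (0, b)
      rw [hb, nb] at this
      linarith
  -- The natural scale is comparable to ‖q.1 - q.2‖, but it is 0 on the diagonal, where rescaling by
  -- s⁻¹ is meaningless. So s decreases to s₀ and the bounds pass to the limit.
  set s₀ := 2 / r * ‖q.1 - q.2‖ with hs₀
  have hs₀r : s₀ < r := by
    rw [hs₀, div_mul_eq_mul_div, div_lt_iff₀ hr]; linarith
  have hs₀0 : 0 ≤ s₀ := by positivity
  have lim : ∀ (A B : ℝ) (k : ℕ),
      (∀ s : ℝ, 0 < s → s < r → ‖q.1 - q.2‖ < r * s → A ≤ B * s ^ k) → A ≤ B * s₀ ^ k := by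
    intro A B k h
    have ht : Tendsto (fun s : ℝ => B * s ^ k) (𝓝[>] s₀) (𝓝 (B * s₀ ^ k)) :=
      (Continuous.tendsto (by fun_prop) s₀).mono_left nhdsWithin_le_nhds
    refine ge_of_tendsto ht ?_
    filter_upwards [self_mem_nhdsWithin, Ioo_mem_nhdsGT hs₀r] with s hs1 hs2
    have hs1 : s₀ < s := hs1
    have hspos : 0 < s := hs₀0.trans_lt hs1
    refine h s hspos hs2.2 ?_
    have h2 : r * s₀ = 2 * ‖q.1 - q.2‖ := by rw [hs₀]; field_simp
    nlinarith [norm_nonneg (q.1 - q.2), mul_lt_mul_of_pos_left hs1 hr]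
  have fin₁ : ∀ A B : ℝ, 0 ≤ B → A ≤ K * B * s₀ ^ (m - 1) →
      A ≤ (K * (2 / r) ^ (m - 1) + K * (2 / r) ^ m) * ‖q.1 - q.2‖ ^ (m - 1) * B := by
    intro A B hB h
    rw [hs₀, mul_pow] at h
    have : 0 ≤ K * (2 / r) ^ m * ‖q.1 - q.2‖ ^ (m - 1) * B := by positivity
    linarith
  have fin₂ : ∀ A B : ℝ, 0 ≤ B → A ≤ K * B * s₀ ^ m →
      A ≤ (K * (2 / r) ^ (m - 1) + K * (2 / r) ^ m) * ‖q.1 - q.2‖ ^ m * B := by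
    intro A B hB h
    rw [hs₀, mul_pow] at h
    have : 0 ≤ K * (2 / r) ^ (m - 1) * ‖q.1 - q.2‖ ^ m * B := by positivity
    linarith
  refine ⟨fin₁ _ _ (by positivity) (lim _ _ _ fun s h1 h2 h3 => (core s h1 h2 h3).1),
    fin₁ _ _ (by positivity) (lim _ _ _ fun s h1 h2 h3 => (core s h1 h2 h3).2.1),
    fin₂ _ _ (by positivity) (lim _ _ _ fun s h1 h2 h3 => (core s h1 h2 h3).2.2.1),
    fin₁ _ _ (by positivity) (lim _ _ _ fun s h1 h2 h3 => (core s h1 h2 h3).2.2.2.1),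
    fin₂ _ _ (by positivity) (lim _ _ _ fun s h1 h2 h3 => (core s h1 h2 h3).2.2.2.2)⟩

end DiagonalEstimates


/-! ### From local bounds to uniform bounds -/

section Compactness

/-- Local bounds with a constant are uniform on a neighbourhood of a compact set. -/
theorem exists_eventually_nhdsSet_of_isCompact {X : Type*} [TopologicalSpace X] {K : Set X}
    (hK : IsCompact K) {P : ℝ → X → Prop} (mono : ∀ x C C', C ≤ C' → P C x → P C' x)
    (h : ∀ x ∈ K, ∃ C, ∀ᶠ y in 𝓝 x, P C y) : ∃ C, ∀ᶠ y in 𝓝ˢ K, P C y := by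
  refine hK.induction_on (p := fun s => ∃ C, ∀ᶠ y in 𝓝ˢ s, P C y) ⟨0, by simp⟩ ?_ ?_ ?_
  · rintro s t hst ⟨C, hC⟩
    exact ⟨C, hC.filter_mono (nhdsSet_mono hst)⟩
  · rintro s t ⟨C, hC⟩ ⟨C', hC'⟩
    refine ⟨max C C', ?_⟩
    rw [nhdsSet_union, eventually_sup]
    exact ⟨hC.mono fun x => mono x _ _ (le_max_left _ _),
      hC'.mono fun x => mono x _ _ (le_max_right _ _)⟩
  · intro x hx
    obtain ⟨C, hC⟩ := h x hx
    refine ⟨{y | ∀ᶠ z in 𝓝 y, P C z}, mem_nhdsWithin_of_mem_nhds hC.eventually_nhds, C, ?_⟩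
    rw [eventually_nhdsSet_iff_forall]
    exact fun y hy => hy

theorem exists_forall_of_isCompact {X : Type*} [TopologicalSpace X] {K : Set X}
    (hK : IsCompact K) {P : ℝ → X → Prop} (mono : ∀ x C C', C ≤ C' → P C x → P C' x)
    (h : ∀ x ∈ K, ∃ C, ∀ᶠ y in 𝓝 x, P C y) : ∃ C, ∀ y ∈ K, P C y := by
  obtain ⟨C, hC⟩ := exists_eventually_nhdsSet_of_isCompact hK mono h
  exact ⟨C, hC.self_of_nhdsSet⟩

/-- A local property near the diagonal of a compact set holds uniformly near the diagonal. -/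
theorem exists_pos_of_eventually_diagonal {X : Type*} [PseudoMetricSpace X] {K : Set X}
    (hK : IsCompact K) {P : ℝ → X × X → Prop} (mono : ∀ x C C', C ≤ C' → P C x → P C' x)
    (h : ∀ x ∈ K, ∃ C, ∀ᶠ q in 𝓝 (x, x), P C q) :
    ∃ C, ∃ ε > 0, ∀ x ∈ K, ∀ x', dist x x' < ε → P C (x, x') := by
  have hK' : IsCompact ((fun x => (x, x)) '' K) := hK.image (by fun_prop)
  obtain ⟨C, hC⟩ := exists_eventually_nhdsSet_of_isCompact hK' mono (by
    rintro _ ⟨x, hx, rfl⟩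
    exact h x hx)
  obtain ⟨U, hU, hKU, hUP⟩ := eventually_nhdsSet_iff_exists.1 hC
  obtain ⟨ε, hε, hsub⟩ := hK'.exists_thickening_subset_open hU hKU
  refine ⟨C, ε, hε, fun x hx x' hxx' => hUP _ (hsub ?_)⟩
  rw [Metric.mem_thickening_iff]
  exact ⟨(x, x), ⟨x, hx, rfl⟩, by
    rw [Prod.dist_eq, max_lt_iff]
    exact ⟨by simpa using hε, by simpa [dist_comm] using hxx'⟩⟩

end Compactness

/-! ### Changes of chart -/

section Chart

variable {n : ℕ} {M : Type*} [TopologicalSpace M] [ChartedSpace (EuclideanSpace ℝ (Fin n)) M]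
  {φ : OpenPartialHomeomorph M (EuclideanSpace ℝ (Fin n))}

theorem mdifferentiable_of_mem_maximalAtlas (hφ : φ ∈ IsManifold.maximalAtlas (𝓡 n) ∞ M) :
    φ.MDifferentiable (𝓡 n) (𝓡 n) :=
  ⟨(contMDiffOn_of_mem_maximalAtlas hφ).mdifferentiableOn (by simp),
    (contMDiffOn_symm_of_mem_maximalAtlas hφ).mdifferentiableOn (by simp)⟩

theorem isInvertible_mfderiv (hφ : φ ∈ IsManifold.maximalAtlas (𝓡 n) ∞ M) {x : M}
    (hx : x ∈ φ.source) : (mfderiv (𝓡 n) 𝓘(ℝ, EuclideanSpace ℝ (Fin n)) φ x).IsInvertible :=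
  ⟨(mdifferentiable_of_mem_maximalAtlas hφ).mfderiv hx, rfl⟩

theorem comp_coordField (hφ : φ ∈ IsManifold.maximalAtlas (𝓡 n) ∞ M) {x : M}
    (hx : x ∈ φ.source) (v : EuclideanSpace ℝ (Fin n)) : comp φ x (coordField φ v x) = v :=
  (isInvertible_mfderiv hφ hx).self_apply_inverse v

theorem contDiffOn_transition {φ₁ φ₂ : OpenPartialHomeomorph M (EuclideanSpace ℝ (Fin n))}
    (h₁ : φ₁ ∈ IsManifold.maximalAtlas (𝓡 n) ∞ M) (h₂ : φ₂ ∈ IsManifold.maximalAtlas (𝓡 n) ∞ M) :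
    ContDiffOn ℝ ∞ (φ₁ ∘ φ₂.symm) (φ₂.target ∩ φ₂.symm ⁻¹' φ₁.source) := by
  rw [← contMDiffOn_iff_contDiffOn]
  exact (contMDiffOn_of_mem_maximalAtlas h₁).comp
    ((contMDiffOn_symm_of_mem_maximalAtlas h₂).mono inter_subset_left) fun y hy => hy.2

theorem contDiffAt_transition {φ₁ φ₂ : OpenPartialHomeomorph M (EuclideanSpace ℝ (Fin n))}
    (h₁ : φ₁ ∈ IsManifold.maximalAtlas (𝓡 n) ∞ M) (h₂ : φ₂ ∈ IsManifold.maximalAtlas (𝓡 n) ∞ M)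
    {x : M} (hx₁ : x ∈ φ₁.source) (hx₂ : x ∈ φ₂.source) :
    ContDiffAt ℝ ∞ (φ₁ ∘ φ₂.symm) (φ₂ x) :=
  (contDiffOn_transition h₁ h₂).contDiffAt <|
    (φ₂.isOpen_inter_preimage_symm φ₁.open_source).mem_nhds
      ⟨φ₂.map_source hx₂, by simpa [φ₂.left_inv hx₂] using hx₁⟩

theorem comp_transition {φ₁ φ₂ : OpenPartialHomeomorph M (EuclideanSpace ℝ (Fin n))}
    (h₁ : φ₁ ∈ IsManifold.maximalAtlas (𝓡 n) ∞ M) (h₂ : φ₂ ∈ IsManifold.maximalAtlas (𝓡 n) ∞ M)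
    {x : M} (hx₁ : x ∈ φ₁.source) (hx₂ : x ∈ φ₂.source) (z : TangentSpace (𝓡 n) x) :
    comp φ₁ x z = fderiv ℝ (φ₁ ∘ φ₂.symm) (φ₂ x) (comp φ₂ x z) := by
  have hev : φ₁ =ᶠ[𝓝 x] (φ₁ ∘ φ₂.symm) ∘ φ₂ := by
    filter_upwards [φ₂.open_source.mem_nhds hx₂] with y hy
    simp [φ₂.left_inv hy]
  have hd : DifferentiableAt ℝ (φ₁ ∘ φ₂.symm) (φ₂ x) :=
    (contDiffAt_transition h₁ h₂ hx₁ hx₂).differentiableAt (by simp)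
  have h := hd.hasFDerivAt.hasMFDerivAt.comp x
    ((mdifferentiable_of_mem_maximalAtlas h₂).mdifferentiableAt hx₂).hasMFDerivAt
  have h' := (h.congr_of_eventuallyEq hev).mfderiv
  unfold comp
  rw [h']
  rfl

theorem exists_transition_bound {φ₁ φ₂ : OpenPartialHomeomorph M (EuclideanSpace ℝ (Fin n))}
    (h₁ : φ₁ ∈ IsManifold.maximalAtlas (𝓡 n) ∞ M) (h₂ : φ₂ ∈ IsManifold.maximalAtlas (𝓡 n) ∞ M)
    {x₀ : M} (hx₁ : x₀ ∈ φ₁.source) (hx₂ : x₀ ∈ φ₂.source) :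
    ∃ C : ℝ, 0 ≤ C ∧ ∀ᶠ x in 𝓝 x₀, ∀ z : TangentSpace (𝓡 n) x,
      ‖comp φ₁ x z‖ ≤ C * ‖comp φ₂ x z‖ := by
  have hc : ContinuousAt (fun x => fderiv ℝ (φ₁ ∘ φ₂.symm) (φ₂ x)) x₀ :=
    ((contDiffAt_transition h₁ h₂ hx₁ hx₂).fderiv_right (m := 0) (by simp)).continuousAt.comp
      (φ₂.continuousAt hx₂)
  refine ⟨‖fderiv ℝ (φ₁ ∘ φ₂.symm) (φ₂ x₀)‖ + 1, by positivity, ?_⟩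
  filter_upwards [φ₁.open_source.mem_nhds hx₁, φ₂.open_source.mem_nhds hx₂,
    hc.norm.eventually_lt_const (lt_add_one _)] with x hs₁ hs₂ hx z
  rw [comp_transition h₁ h₂ hs₁ hs₂]
  exact ContinuousLinearMap.le_of_opNorm_le _ hx.le _

theorem comp_sub (x : M) (z z' : TangentSpace (𝓡 n) x) :
    comp φ x (z - z') = comp φ x z - comp φ x z' :=
  map_sub (mfderiv (𝓡 n) 𝓘(ℝ, EuclideanSpace ℝ (Fin n)) φ x) z z'

end Chart

/-! ### Riemannian norm against Euclidean norm of components -/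

section Metric

variable {n : ℕ} {M : Type*} [TopologicalSpace M]
    [ChartedSpace (EuclideanSpace ℝ (Fin n)) M] [IsManifold (𝓡 n) ∞ M]
    [RiemannianBundle (fun x : M => TangentSpace (𝓡 n) x)]
    {φ : OpenPartialHomeomorph M (EuclideanSpace ℝ (Fin n))}

theorem isContinuousRiemannianBundle
    [IsContMDiffRiemannianBundle (𝓡 n) ∞ (EuclideanSpace ℝ (Fin n))
      (fun x : M => TangentSpace (𝓡 n) x)] :
    IsContinuousRiemannianBundle (EuclideanSpace ℝ (Fin n))
      (fun x : M => TangentSpace (𝓡 n) x) := by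
  obtain ⟨g, hg, h⟩ := IsContMDiffRiemannianBundle.exists_contMDiff (IB := 𝓡 n) (n := ∞)
    (F := EuclideanSpace ℝ (Fin n)) (E := fun x : M => TangentSpace (𝓡 n) x)
  exact ⟨g, hg.continuous, h⟩

variable [IsContinuousRiemannianBundle (EuclideanSpace ℝ (Fin n))
      (fun x : M => TangentSpace (𝓡 n) x)]

/-- The Riemannian norm is locally comparable with the Euclidean norm of the components. -/
theorem exists_norm_comp_le (hφ : φ ∈ IsManifold.maximalAtlas (𝓡 n) ∞ M) {x₀ : M}
    (hx₀ : x₀ ∈ φ.source) :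
    ∃ C : ℝ, 0 ≤ C ∧ ∀ᶠ x in 𝓝 x₀, ∀ z : TangentSpace (𝓡 n) x,
      ‖comp φ x z‖ ≤ C * ‖z‖ ∧ ‖z‖ ≤ C * ‖comp φ x z‖ := by
  obtain ⟨C₁, hC₁, h₁⟩ := eventually_norm_trivializationAt_lt (EuclideanSpace ℝ (Fin n))
    (fun x : M => TangentSpace (𝓡 n) x) x₀
  obtain ⟨C₂, hC₂, h₂⟩ := eventually_norm_symmL_trivializationAt_lt (EuclideanSpace ℝ (Fin n))
    (fun x : M => TangentSpace (𝓡 n) x) x₀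
  -- The trivialization of the tangent bundle at x₀ is the derivative of the preferred chart ψ; the
  -- estimates are carried from ψ to φ by the transition maps.
  set ψ := chartAt (EuclideanSpace ℝ (Fin n)) x₀ with hψdef
  have hψ : ψ ∈ IsManifold.maximalAtlas (𝓡 n) ∞ M := IsManifold.chart_mem_maximalAtlas x₀
  have hx₀ψ : x₀ ∈ ψ.source := mem_chart_source _ x₀
  set T := trivializationAt (EuclideanSpace ℝ (Fin n)) (fun x : M => TangentSpace (𝓡 n) x) x₀
  have hTA : ∀ x ∈ ψ.source, ∀ z : TangentSpace (𝓡 n) x,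
      T.continuousLinearMapAt ℝ x z = comp ψ x z := by
    intro x hx z
    rw [TangentBundle.continuousLinearMapAt_trivializationAt hx]
    rfl
  obtain ⟨C₃, hC₃, h₃⟩ := exists_transition_bound hφ hψ hx₀ hx₀ψ
  obtain ⟨C₄, hC₄, h₄⟩ := exists_transition_bound hψ hφ hx₀ψ hx₀
  refine ⟨C₃ * C₁ + C₂ * C₄, by positivity, ?_⟩
  filter_upwards [h₁, h₂, h₃, h₄, ψ.open_source.mem_nhds hx₀ψ] with x b₁ b₂ b₃ b₄ hx z
  have hz : T.symmL ℝ x (T.continuousLinearMapAt ℝ x z) = z :=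
    T.symmL_continuousLinearMapAt hx z
  constructor
  · calc ‖comp φ x z‖ ≤ C₃ * ‖comp ψ x z‖ := b₃ z
      _ ≤ C₃ * (C₁ * ‖z‖) := by
        gcongr
        rw [← hTA x hx]
        exact ContinuousLinearMap.le_of_opNorm_le _ b₁.le _
      _ ≤ (C₃ * C₁ + C₂ * C₄) * ‖z‖ := by
        have : 0 ≤ C₂ * C₄ * ‖z‖ := by positivity
        linarith
  · calc ‖z‖ = ‖T.symmL ℝ x (T.continuousLinearMapAt ℝ x z)‖ := by rw [hz]
      _ ≤ C₂ * ‖T.continuousLinearMapAt ℝ x z‖ := ContinuousLinearMap.le_of_opNorm_le _ b₂.le _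
      _ ≤ C₂ * (C₄ * ‖comp φ x z‖) := by
        gcongr
        rw [hTA x hx]
        exact b₄ z
      _ ≤ (C₃ * C₁ + C₂ * C₄) * ‖comp φ x z‖ := by
        have : 0 ≤ C₃ * C₁ * ‖comp φ x z‖ := by positivity
        linarith

end Metric

/-! ### Riemannian distance against chart distance -/

section Distance

variable {n : ℕ} {M : Type*} [MetricSpace M]
    [ChartedSpace (EuclideanSpace ℝ (Fin n)) M] [IsManifold (𝓡 n) ∞ M]
    [RiemannianBundle (fun x : M => TangentSpace (𝓡 n) x)]
    [IsContinuousRiemannianBundle (EuclideanSpace ℝ (Fin n))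
      (fun x : M => TangentSpace (𝓡 n) x)]
    [IsRiemannianManifold (𝓡 n) M]
    {φ : OpenPartialHomeomorph M (EuclideanSpace ℝ (Fin n))}

theorem exists_dist_le_norm_sub (hφ : φ ∈ IsManifold.maximalAtlas (𝓡 n) ∞ M) {x₀ : M}
    (hx₀ : x₀ ∈ φ.source) :
    ∃ C : ℝ, 0 ≤ C ∧ ∀ᶠ x in 𝓝 x₀, dist x x₀ ≤ C * ‖φ x - φ x₀‖ := by
  obtain ⟨C, hC, h⟩ := eventually_riemannianEDist_le_edist_extChartAt (𝓡 n) x₀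
  set ψ := chartAt (EuclideanSpace ℝ (Fin n)) x₀ with hψdef
  have hψ : ψ ∈ IsManifold.maximalAtlas (𝓡 n) ∞ M := IsManifold.chart_mem_maximalAtlas x₀
  have hx₀ψ : x₀ ∈ ψ.source := mem_chart_source _ x₀
  have hcd := contDiffAt_transition hψ hφ hx₀ψ hx₀
  obtain ⟨L, s, hs, hL⟩ := (hcd.of_le (m := 1) (by simp)).exists_lipschitzOnWith
  refine ⟨C * L, by positivity, ?_⟩
  filter_upwards [h, φ.open_source.mem_nhds hx₀,
    (φ.continuousAt hx₀).preimage_mem_nhds hs] with x hx hxs hxs'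
  have h1 := hL.dist_le_mul _ hxs' _ (mem_of_mem_nhds hs)
  simp only [Function.comp_apply, φ.left_inv hxs, φ.left_inv hx₀] at h1
  rw [← IsRiemannianManifold.out (I := 𝓡 n)] at hx
  have h2 : dist x x₀ ≤ C * dist (ψ x) (ψ x₀) := by
    rw [dist_comm x, dist_comm (ψ x), dist_edist, dist_edist, ← ENNReal.coe_toReal C,
      ← ENNReal.toReal_mul]
    exact ENNReal.toReal_mono (ENNReal.mul_ne_top (by simp) (edist_ne_top _ _)) hx
  rw [dist_eq_norm (φ x)] at h1
  calc dist x x₀ ≤ C * dist (ψ x) (ψ x₀) := h2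
    _ ≤ C * (L * ‖φ x - φ x₀‖) := by gcongr
    _ = C * L * ‖φ x - φ x₀‖ := by ring

/-- A path of length less than L, for L slightly above the distance, stays in a ball where the
derivative of φ is bounded by C, so its image has length at most C L; then L decreases to the
distance. -/
theorem exists_norm_sub_le_dist (hφ : φ ∈ IsManifold.maximalAtlas (𝓡 n) ∞ M) {x₀ : M}
    (hx₀ : x₀ ∈ φ.source) :
    ∃ C : ℝ, 0 ≤ C ∧ ∀ᶠ q in 𝓝 (x₀, x₀), ‖φ q.1 - φ q.2‖ ≤ C * dist q.1 q.2 := by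
  obtain ⟨C, hC, h⟩ := exists_norm_comp_le hφ hx₀
  lift C to NNReal using hC
  refine ⟨C, C.2, ?_⟩
  obtain ⟨r, hr, hball⟩ := Metric.eventually_nhds_iff_ball.1
    (h.and (φ.open_source.mem_nhds hx₀ : ∀ᶠ x in 𝓝 x₀, x ∈ φ.source))
  -- With both points within r / 3 of x₀ and L < 2 r / 3, every point of the path is within r of x₀.
  have hr3 : 0 < r / 3 := by positivity
  filter_upwards [Metric.ball_mem_nhds (x₀, x₀) hr3] with q hq
  rw [← ball_prod_same] at hq
  obtain ⟨hq₁, hq₂⟩ := hq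
  rw [Metric.mem_ball] at hq₁ hq₂
  have hd : dist q.1 q.2 < 2 * (r / 3) := by
    have := dist_triangle_right q.1 q.2 x₀
    linarith
  have key : ∀ L : ℝ, dist q.1 q.2 < L → L < 2 * (r / 3) → ‖φ q.1 - φ q.2‖ ≤ C * L := by
    intro L hL hLr
    have hL0 : 0 < L := dist_nonneg.trans_lt hL
    have hLe : Manifold.riemannianEDist (𝓡 n) q.1 q.2 < ENNReal.ofReal L := by
      rw [← IsRiemannianManifold.out (I := 𝓡 n), edist_dist]
      exact (ENNReal.ofReal_lt_ofReal_iff hL0).2 hL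
    obtain ⟨γ, h0, h1, hγ, hlen⟩ := Manifold.exists_lt_of_riemannianEDist_lt hLe
    have hin : ∀ t ∈ Icc (0 : ℝ) 1, γ t ∈ Metric.ball x₀ r := by
      intro t ht
      have e1 : edist q.1 (γ t) < ENNReal.ofReal L := by
        rw [IsRiemannianManifold.out (I := 𝓡 n)]
        refine lt_of_le_of_lt ?_ hlen
        refine (Manifold.riemannianEDist_le_pathELength
          (hγ.mono (Icc_subset_Icc_right ht.2)) h0 rfl ht.1).trans ?_
        exact Manifold.pathELength_mono le_rfl ht.2
      rw [edist_dist, ENNReal.ofReal_lt_ofReal_iff hL0] at e1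
      have := dist_triangle_left (γ t) x₀ q.1
      rw [Metric.mem_ball]
      linarith
    have hφγ : ContDiffOn ℝ 1 (φ ∘ γ) (Icc 0 1) := by
      rw [← contMDiffOn_iff_contDiffOn]
      exact ((contMDiffOn_of_mem_maximalAtlas hφ).of_le (by simp)).comp hγ
        fun t ht => (hball _ (hin t ht)).2
    have hpt : ∀ t ∈ Icc (0 : ℝ) 1, ‖derivWithin (φ ∘ γ) (Icc 0 1) t‖ₑ
        ≤ C * ‖mfderivWithin 𝓘(ℝ, ℝ) (𝓡 n) γ (Icc 0 1) t 1‖ₑ := by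
      intro t ht
      have hb := hball _ (hin t ht)
      have hcomp : mfderivWithin 𝓘(ℝ, ℝ) (𝓡 n) (φ ∘ γ) (Icc 0 1) t
          = (mfderiv (𝓡 n) (𝓡 n) φ (γ t)).comp
            (mfderivWithin 𝓘(ℝ, ℝ) (𝓡 n) γ (Icc 0 1) t) := by
        apply mfderiv_comp_mfderivWithin
        · exact (mdifferentiable_of_mem_maximalAtlas hφ).mdifferentiableAt hb.2
        · exact hγ.mdifferentiableOn one_ne_zero t ht
        · rw [uniqueMDiffWithinAt_iff_uniqueDiffWithinAt]
          exact uniqueDiffOn_Icc zero_lt_one t ht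
      have e : derivWithin (φ ∘ γ) (Icc 0 1) t
          = comp φ (γ t) (mfderivWithin 𝓘(ℝ, ℝ) (𝓡 n) γ (Icc 0 1) t 1) := by
        rw [← fderivWithin_derivWithin, ← mfderivWithin_eq_fderivWithin, hcomp]
        rfl
      rw [e]
      have := (hb.1 (mfderivWithin 𝓘(ℝ, ℝ) (𝓡 n) γ (Icc 0 1) t 1)).1
      rw [← ofReal_norm, ← ofReal_norm, ← ENNReal.ofReal_coe_nnreal,
        ← ENNReal.ofReal_mul C.coe_nonneg]
      exact ENNReal.ofReal_le_ofReal this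
    have hfin : ‖φ q.2 - φ q.1‖ₑ ≤ C * ENNReal.ofReal L := by
      calc ‖φ q.2 - φ q.1‖ₑ = ‖(φ ∘ γ) 1 - (φ ∘ γ) 0‖ₑ := by simp [h0, h1]
        _ ≤ ∫⁻ t in Icc (0 : ℝ) 1, ‖derivWithin (φ ∘ γ) (Icc 0 1) t‖ₑ :=
          enorm_sub_le_lintegral_derivWithin_Icc_of_contDiffOn_Icc hφγ zero_le_one
        _ ≤ ∫⁻ t in Icc (0 : ℝ) 1, C * ‖mfderivWithin 𝓘(ℝ, ℝ) (𝓡 n) γ (Icc 0 1) t 1‖ₑ :=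
          MeasureTheory.setLIntegral_mono' measurableSet_Icc hpt
        _ = C * Manifold.pathELength (𝓡 n) γ 0 1 := by
          rw [MeasureTheory.lintegral_const_mul' _ _ ENNReal.coe_ne_top,
            Manifold.pathELength_eq_lintegral_mfderivWithin_Icc]
        _ ≤ C * ENNReal.ofReal L := by gcongr
    rw [← ofReal_norm, ← ENNReal.ofReal_coe_nnreal, ← ENNReal.ofReal_mul C.coe_nonneg,
      ENNReal.ofReal_le_ofReal_iff (by positivity), norm_sub_rev] at hfin
    exact hfin
  have ht : Tendsto (fun L : ℝ => C * L) (𝓝[>] dist q.1 q.2) (𝓝 (C * dist q.1 q.2)) :=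
    (Continuous.tendsto (by fun_prop) _).mono_left nhdsWithin_le_nhds
  refine ge_of_tendsto ht ?_
  filter_upwards [Ioo_mem_nhdsGT hd] with L hL using key L hL.1 hL.2

end Distance


/-! ### Bilinearity and smoothness of the Christoffel symbols -/

section Christoffel

variable {n : ℕ} {M : Type*} [TopologicalSpace M]
  [ChartedSpace (EuclideanSpace ℝ (Fin n)) M] {φ : OpenPartialHomeomorph M (EuclideanSpace ℝ (Fin n))}

theorem coordField_add (v v' : EuclideanSpace ℝ (Fin n)) :
    coordField (M := M) φ (v + v') = coordField φ v + coordField φ v' := by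
  funext x
  exact map_add (mfderiv (𝓡 n) 𝓘(ℝ, EuclideanSpace ℝ (Fin n)) φ x).inverse v v'

theorem coordField_smul (a : ℝ) (v : EuclideanSpace ℝ (Fin n)) :
    coordField (M := M) φ (a • v) = a • coordField φ v := by
  funext x
  exact map_smul (mfderiv (𝓡 n) 𝓘(ℝ, EuclideanSpace ℝ (Fin n)) φ x).inverse a v

variable [IsManifold (𝓡 n) ∞ M]

theorem contMDiffAt_coordField (hφ : φ ∈ IsManifold.maximalAtlas (𝓡 n) ∞ M) {x₀ : M}
    (hx₀ : x₀ ∈ φ.source) (v : EuclideanSpace ℝ (Fin n)) :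
    ContMDiffAt (𝓡 n) (𝓡 n).tangent ∞
      (fun x => (⟨x, coordField φ v x⟩ : TangentBundle (𝓡 n) M)) x₀ := by
  have hV := (contMDiffAt_vectorSpace_iff_contDiffAt (𝕜 := ℝ) (n := ∞) (x := φ x₀)
    (V := fun _ : EuclideanSpace ℝ (Fin n) => v)).2 contDiffAt_const
  exact ContMDiffAt.mpullback_vectorField_preimage (n := ∞) (m := ∞) hV
    (contMDiffAt_of_mem_maximalAtlas hφ hx₀)
    (isInvertible_mfderiv hφ hx₀) (by simp)

/-- In the preferred chart the components are the trivialized section; the derivative of the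
transition map, which is smooth, converts them to φ. -/
theorem contMDiffAt_comp_section (hφ : φ ∈ IsManifold.maximalAtlas (𝓡 n) ∞ M) {x₀ : M}
    (hx₀ : x₀ ∈ φ.source) {Z : ∀ x : M, TangentSpace (𝓡 n) x}
    (hZ : ContMDiffAt (𝓡 n) (𝓡 n).tangent ∞
      (fun x => (⟨x, Z x⟩ : TangentBundle (𝓡 n) M)) x₀) :
    ContMDiffAt (𝓡 n) 𝓘(ℝ, EuclideanSpace ℝ (Fin n)) ∞ (fun x => comp φ x (Z x)) x₀ := by
  have h1 := (contMDiffAt_totalSpace.1 hZ).2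
  set ψ := chartAt (EuclideanSpace ℝ (Fin n)) x₀ with hψdef
  have hψ : ψ ∈ IsManifold.maximalAtlas (𝓡 n) ∞ M := IsManifold.chart_mem_maximalAtlas x₀
  have hx₀ψ : x₀ ∈ ψ.source := mem_chart_source _ x₀
  have h2 : ContMDiffAt (𝓡 n) 𝓘(ℝ, EuclideanSpace ℝ (Fin n)) ∞ (fun x => comp ψ x (Z x)) x₀ := by
    refine h1.congr_of_eventuallyEq ?_
    filter_upwards [ψ.open_source.mem_nhds hx₀ψ] with x hx
    change _ = (trivializationAt (EuclideanSpace ℝ (Fin n))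
      (fun x : M => TangentSpace (𝓡 n) x) x₀ ⟨x, Z x⟩).2
    rw [← Trivialization.continuousLinearMapAt_apply_of_mem (R := ℝ) _ hx,
      TangentBundle.continuousLinearMapAt_trivializationAt hx]
    rfl
  have h3 : ContMDiffAt (𝓡 n) 𝓘(ℝ, EuclideanSpace ℝ (Fin n) →L[ℝ] EuclideanSpace ℝ (Fin n)) ∞
      (fun x => fderiv ℝ (φ ∘ ψ.symm) (ψ x)) x₀ :=
    ((contDiffAt_transition hφ hψ hx₀ hx₀ψ).fderiv_right (m := ∞) (by simp)).contMDiffAt.comp x₀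
      (contMDiffAt_of_mem_maximalAtlas hψ hx₀ψ)
  refine (h3.clm_apply h2).congr_of_eventuallyEq ?_
  filter_upwards [φ.open_source.mem_nhds hx₀, ψ.open_source.mem_nhds hx₀ψ] with x hx hx'
  exact comp_transition hφ hψ hx hx' _

variable (cov : CovariantDerivative (𝓡 n) (EuclideanSpace ℝ (Fin n))
      (fun x : M => TangentSpace (𝓡 n) x))

theorem christoffel_add_left (y u u' v : EuclideanSpace ℝ (Fin n)) :
    christoffel cov φ y (u + u') v = christoffel cov φ y u v + christoffel cov φ y u' v := by
  unfold christoffel comp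
  rw [coordField_add]
  simp only [Pi.add_apply]
  erw [map_add, map_add]
  rfl

theorem christoffel_smul_left (a : ℝ) (y u v : EuclideanSpace ℝ (Fin n)) :
    christoffel cov φ y (a • u) v = a • christoffel cov φ y u v := by
  unfold christoffel comp
  rw [coordField_smul]
  simp only [Pi.smul_apply]
  erw [map_smul, map_smul]
  rfl

theorem christoffel_add_right (hφ : φ ∈ IsManifold.maximalAtlas (𝓡 n) ∞ M)
    {y : EuclideanSpace ℝ (Fin n)} (hy : y ∈ φ.target) (u v v' : EuclideanSpace ℝ (Fin n)) :
    christoffel cov φ y u (v + v') = christoffel cov φ y u v + christoffel cov φ y u v' := by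
  unfold christoffel comp
  have hx := φ.map_target hy
  rw [coordField_add, cov.isCovariantDerivativeOnUniv.add
    ((contMDiffAt_coordField hφ hx v).mdifferentiableAt (by simp))
    ((contMDiffAt_coordField hφ hx v').mdifferentiableAt (by simp))]
  exact map_add (mfderiv (𝓡 n) 𝓘(ℝ, EuclideanSpace ℝ (Fin n)) φ (φ.symm y)) _ _

theorem christoffel_smul_right (hφ : φ ∈ IsManifold.maximalAtlas (𝓡 n) ∞ M)
    {y : EuclideanSpace ℝ (Fin n)} (hy : y ∈ φ.target) (a : ℝ) (u v : EuclideanSpace ℝ (Fin n)) :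
    christoffel cov φ y u (a • v) = a • christoffel cov φ y u v := by
  unfold christoffel comp
  have hx := φ.map_target hy
  rw [coordField_smul, cov.isCovariantDerivativeOnUniv.smul_const a
    ((contMDiffAt_coordField hφ hx v).mdifferentiableAt (by simp))]
  exact map_smul (mfderiv (𝓡 n) 𝓘(ℝ, EuclideanSpace ℝ (Fin n)) φ (φ.symm y)) a _

/-- Smoothness of the connection is applied to globally smooth sections, so the coordinate field is
cut off by a bump function. As ∇ is local, nothing changes where the bump function is 1. -/
theorem contDiffAt_christoffel [T2Space M]
    [CovariantDerivative.ContMDiffCovariantDerivative cov ∞]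
    (hφ : φ ∈ IsManifold.maximalAtlas (𝓡 n) ∞ M)
    {y₀ : EuclideanSpace ℝ (Fin n)} (hy₀ : y₀ ∈ φ.target) (u v : EuclideanSpace ℝ (Fin n)) :
    ContDiffAt ℝ ∞ (fun y => christoffel cov φ y u v) y₀ := by
  set x₀ := φ.symm y₀ with hx₀def
  have hx₀ : x₀ ∈ φ.source := φ.map_target hy₀
  obtain ⟨f, -, hf⟩ := (SmoothBumpFunction.nhds_basis_tsupport (I := 𝓡 n) x₀).mem_iff.1
    (φ.open_source.mem_nhds hx₀)
  set σ : ∀ x : M, TangentSpace (𝓡 n) x := (f : M → ℝ) • coordField φ v with hσ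
  have hσs : ContMDiff (𝓡 n) (𝓡 n).tangent ∞
      (fun x => (⟨x, σ x⟩ : TangentBundle (𝓡 n) M)) := by
    intro x
    by_cases hx : x ∈ φ.source
    · exact (f.contMDiff x).smul_section (contMDiffAt_coordField hφ hx v)
    · have hx' : x ∉ tsupport f := fun h => hx (hf h)
      have hz : ContMDiffAt (𝓡 n) (𝓡 n).tangent ∞
        (fun x => (⟨x, (0 : TangentSpace (𝓡 n) x)⟩ : TangentBundle (𝓡 n) M)) x :=
        (Bundle.contMDiff_zeroSection ℝ (fun x : M => TangentSpace (𝓡 n) x)) x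
      refine hz.congr_of_eventuallyEq ?_
      filter_upwards [(isClosed_tsupport f).isOpen_compl.mem_nhds hx'] with y hy
      have : f y = 0 := image_eq_zero_of_notMem_tsupport hy
      simp [σ, this]
  have hcov := (CovariantDerivative.ContMDiffCovariantDerivative.contMDiff
    (cov := cov) (k := ∞)).contMDiff (σ := σ) (by simpa using hσs.contMDiffOn)
  have h1 : ContMDiffAt (𝓡 n) (𝓡 n).tangent ∞
      (fun x => (⟨x, cov σ x (coordField φ u x)⟩ : TangentBundle (𝓡 n) M)) x₀ :=
    ContMDiffAt.clm_bundle_apply ((hcov x₀ (mem_univ _)).contMDiffAt univ_mem)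
      (contMDiffAt_coordField hφ hx₀ u)
  have h2 := contMDiffAt_comp_section hφ hx₀ h1
  have h3 : ContMDiffAt (𝓡 n) 𝓘(ℝ, EuclideanSpace ℝ (Fin n)) ∞
      (fun y => comp φ (φ.symm y) (cov σ (φ.symm y) (coordField φ u (φ.symm y)))) y₀ :=
    ContMDiffAt.comp (g := fun x => comp φ x (cov σ x (coordField φ u x))) y₀ h2
      (contMDiffAt_symm_of_mem_maximalAtlas hφ hy₀)
  refine h3.contDiffAt.congr_of_eventuallyEq ?_
  have hone : ∀ᶠ x in 𝓝 x₀, ∀ᶠ x' in 𝓝 x, f x' = 1 := by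
    have := f.eventuallyEq_one
    exact this.eventually_nhds
  filter_upwards [(φ.symm.continuousAt hy₀).eventually hone, φ.open_target.mem_nhds hy₀]
    with y hy hyt
  have hx := φ.map_target hyt
  unfold christoffel
  rw [cov.isCovariantDerivativeOnUniv.congr_of_eventuallyEq (σ := coordField φ v) (σ' := σ)
    ((contMDiffAt_coordField hφ hx v).mdifferentiableAt (by simp))
    ((hσs _).mdifferentiableAt (by simp)) univ_mem]
  filter_upwards [hy] with x hx1
  simp [σ, hx1]

end Christoffel


/-! ### Linear differential equations on [0, 1] -/

section LinearODE

variable {E : Type*} [NormedAddCommGroup E] [NormedSpace ℝ E]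

theorem norm_le_exp_of_linear_ode {A : ℝ → E → E} {c : ℝ} {w : ℝ → E}
    (hA : ∀ t ∈ Icc (0 : ℝ) 1, ‖A t (w t)‖ ≤ c * ‖w t‖)
    (hw : ∀ t ∈ Icc (0 : ℝ) 1, HasDerivWithinAt w (-A t (w t)) (Icc 0 1) t) :
    ∀ t ∈ Icc (0 : ℝ) 1, ‖w t‖ ≤ ‖w 0‖ * Real.exp (c * t) := by
  intro t ht
  have := norm_le_gronwallBound_of_norm_deriv_right_le (f := w) (f' := fun t => -A t (w t))
    (δ := ‖w 0‖) (K := c) (ε := 0) (a := 0) (b := 1)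
    (fun t ht => (hw t ht).continuousWithinAt)
    (fun t ht => ((hw t (Ico_subset_Icc_self ht)).mono_of_mem_nhdsWithin
      (Icc_mem_nhdsGE_of_mem ht))) le_rfl
    (fun t ht => by simpa using hA t (Ico_subset_Icc_self ht)) t ht
  simpa [gronwallBound_ε0] using this

theorem norm_sub_le_of_linear_ode {A : ℝ → E → E} {c : ℝ} (hc : 0 ≤ c) {w : ℝ → E}
    (hA : ∀ t ∈ Icc (0 : ℝ) 1, ‖A t (w t)‖ ≤ c * ‖w t‖)
    (hw : ∀ t ∈ Icc (0 : ℝ) 1, HasDerivWithinAt w (-A t (w t)) (Icc 0 1) t) :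
    ‖w 1 - w 0‖ ≤ c * (‖w 0‖ * Real.exp c) := by
  have h := norm_le_exp_of_linear_ode hA hw
  have := (convex_Icc (0 : ℝ) 1).norm_image_sub_le_of_norm_hasDerivWithin_le
    (C := c * (‖w 0‖ * Real.exp c)) hw (fun t ht => ?_)
    (left_mem_Icc.2 zero_le_one) (right_mem_Icc.2 zero_le_one)
  · simpa using this
  · rw [norm_neg]
    refine (hA t ht).trans ?_
    gcongr
    refine (h t ht).trans ?_
    gcongr
    exact mul_le_of_le_one_right hc ht.2

/-- The bound 1 / 2 makes one Picard–Lindelöf step enough: on the ball of radius ‖w₀‖ about w₀ the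
field is at most (1 / 2) · 2 ‖w₀‖, so the solution cannot leave the ball before time 1. -/
theorem exists_solution_of_linear_ode [CompleteSpace E] {A : ℝ → E →L[ℝ] E}
    (hcont : ContinuousOn A (Icc 0 1)) (hA : ∀ t ∈ Icc (0 : ℝ) 1, ‖A t‖ ≤ 1 / 2) (w₀ : E) :
    ∃ w : ℝ → E, w 0 = w₀ ∧
      ∀ t ∈ Icc (0 : ℝ) 1, HasDerivWithinAt w (-A t (w t)) (Icc 0 1) t := by
  have hPL : IsPicardLindelof (fun t w => -A t w) (tmin := 0) (tmax := 1)
      ⟨0, left_mem_Icc.2 zero_le_one⟩ w₀ ‖w₀‖₊ 0 ‖w₀‖₊ 1 := by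
    refine ⟨fun t ht => ?_, fun x _ => (hcont.clm_apply continuousOn_const).neg,
      fun t ht x hx => ?_, by simp⟩
    · refine (LipschitzWith.of_dist_le_mul fun x y => ?_).lipschitzOnWith
      rw [dist_neg_neg, dist_eq_norm, dist_eq_norm, ← map_sub]
      refine (ContinuousLinearMap.le_of_opNorm_le _ (hA t ht) _).trans ?_
      have := norm_nonneg (x - y)
      simp only [NNReal.coe_one]
      linarith
    · rw [norm_neg]
      refine (ContinuousLinearMap.le_of_opNorm_le _ (hA t ht) _).trans ?_
      have h1 : ‖x‖ ≤ ‖w₀‖ + ‖x - w₀‖ := norm_le_insert' x w₀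
      have h2 : ‖x - w₀‖ ≤ ‖w₀‖ := by simpa [dist_eq_norm] using hx
      simp only [coe_nnnorm]
      linarith
  exact hPL.exists_eq_forall_mem_Icc_hasDerivWithinAt₀

end LinearODE

/-! ### Christoffel symbols as continuous bilinear maps -/

section ChristoffelBounds

variable {n : ℕ} {M : Type*} [TopologicalSpace M]
  [ChartedSpace (EuclideanSpace ℝ (Fin n)) M] [IsManifold (𝓡 n) ∞ M]
  (cov : CovariantDerivative (𝓡 n) (EuclideanSpace ℝ (Fin n))
      (fun x : M => TangentSpace (𝓡 n) x))
  (φ : OpenPartialHomeomorph M (EuclideanSpace ℝ (Fin n)))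

/-- The Christoffel symbols as a continuous bilinear map. -/
def christoffelCLM (y : EuclideanSpace ℝ (Fin n)) :
    EuclideanSpace ℝ (Fin n) →L[ℝ] EuclideanSpace ℝ (Fin n) →L[ℝ] EuclideanSpace ℝ (Fin n) :=
  ∑ i, ∑ j, (EuclideanSpace.proj i : EuclideanSpace ℝ (Fin n) →L[ℝ] ℝ).smulRight
    ((EuclideanSpace.proj j : EuclideanSpace ℝ (Fin n) →L[ℝ] ℝ).smulRight
      (christoffel cov φ y (EuclideanSpace.single i 1) (EuclideanSpace.single j 1)))

variable {φ}

theorem christoffelCLM_apply (hφ : φ ∈ IsManifold.maximalAtlas (𝓡 n) ∞ M)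
    {y : EuclideanSpace ℝ (Fin n)} (hy : y ∈ φ.target) (u v : EuclideanSpace ℝ (Fin n)) :
    christoffelCLM cov φ y u v = christoffel cov φ y u v := by
  let B : EuclideanSpace ℝ (Fin n) →ₗ[ℝ] EuclideanSpace ℝ (Fin n) →ₗ[ℝ]
      EuclideanSpace ℝ (Fin n) :=
    LinearMap.mk₂ ℝ (christoffel cov φ y) (fun u u' v => christoffel_add_left cov y u u' v)
      (fun a u v => christoffel_smul_left cov a y u v)
      (fun u v v' => christoffel_add_right cov hφ hy u v v')
      (fun a u v => christoffel_smul_right cov hφ hy a u v)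
  have hsum : ∀ w : EuclideanSpace ℝ (Fin n), w = ∑ i, w i • EuclideanSpace.single i (1 : ℝ) :=
    fun w => by simpa using ((EuclideanSpace.basisFun (Fin n) ℝ).sum_repr w).symm
  have hB : christoffel cov φ y u v = B u v := rfl
  rw [hB]
  conv_rhs => rw [hsum u, hsum v]
  simp only [christoffelCLM, sum_apply, ContinuousLinearMap.smulRight_apply,
    map_sum, LinearMap.sum_apply, map_smul, LinearMap.smul_apply, smul_apply, Finset.smul_sum]
  rw [Finset.sum_comm]
  refine Finset.sum_congr rfl fun j _ => Finset.sum_congr rfl fun i _ => ?_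
  rw [smul_comm]
  rfl

theorem contDiffAt_christoffelCLM [T2Space M]
    [CovariantDerivative.ContMDiffCovariantDerivative cov ∞]
    (hφ : φ ∈ IsManifold.maximalAtlas (𝓡 n) ∞ M)
    {y₀ : EuclideanSpace ℝ (Fin n)} (hy₀ : y₀ ∈ φ.target) :
    ContDiffAt ℝ ∞ (christoffelCLM cov φ) y₀ := by
  refine ContDiffAt.sum fun i _ => ContDiffAt.sum fun j _ => ?_
  exact contDiffAt_const.smulRight (contDiffAt_const.smulRight
    (contDiffAt_christoffel cov hφ hy₀ _ _))

end ChristoffelBounds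


/-! ### Velocity of the geodesics -/

section GeodesicVelocity

variable {n : ℕ} {M : Type*} [MetricSpace M]
  [ChartedSpace (EuclideanSpace ℝ (Fin n)) M] [IsManifold (𝓡 n) ∞ M]
  {cov : CovariantDerivative (𝓡 n) (EuclideanSpace ℝ (Fin n))
      (fun x : M => TangentSpace (𝓡 n) x)}
  {φ : OpenPartialHomeomorph M (EuclideanSpace ℝ (Fin n))} {K : Set M} {G : M × M × ℝ → M}

/-- The velocity, in the chart `φ`, of the curve `G (x, x', ·)` on `[0, 1]`. -/
def velocity (φ : OpenPartialHomeomorph M (EuclideanSpace ℝ (Fin n))) (G : M × M × ℝ → M)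
    (x x' : M) (t : ℝ) : EuclideanSpace ℝ (Fin n) :=
  derivWithin (fun s => φ (G (x, x', s))) (Icc 0 1) t

theorem isGeodesicOn_const (hφ : φ ∈ IsManifold.maximalAtlas (𝓡 n) ∞ M) {x : M}
    (hx : x ∈ φ.source) : IsGeodesicOn cov φ (fun _ => x) (Icc 0 1) := by
  refine ⟨fun _ _ => hx, fun _ => 0, fun t _ => ⟨hasDerivWithinAt_const _ _ _, ?_⟩⟩
  have : christoffel cov φ (φ x) 0 0 = 0 := by
    rw [← christoffelCLM_apply cov hφ (φ.map_source hx)]; simp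
  rw [this, neg_zero]
  exact hasDerivWithinAt_const _ _ _

/-- The constant curve is a geodesic, so by uniqueness it is the one from x to x. -/
theorem IsGeodesicMap.velocity_self (hG : IsGeodesicMap cov φ K G)
    (hφ : φ ∈ IsManifold.maximalAtlas (𝓡 n) ∞ M) (hK : K ⊆ φ.source) {x : M} (hx : x ∈ K)
    {t : ℝ} (ht : t ∈ Icc (0 : ℝ) 1) : velocity φ G x x t = 0 := by
  have hconst := hG.unique x hx x hx (fun _ => x) (isGeodesicOn_const hφ (hK hx))
    (fun _ _ => hx) rfl rfl
  have : EqOn (fun s => φ (G (x, x, s))) (fun _ => φ x) (Icc 0 1) := fun s hs => by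
    have := hconst hs
    simp only at this ⊢
    rw [← this]
  unfold velocity
  rw [derivWithin_congr this (this ht), derivWithin_fun_const]
  rfl

/-- In coordinates, the velocity is a smooth function of the endpoints and the time. -/
theorem IsGeodesicMap.exists_velocity_eq (hG : IsGeodesicMap cov φ K G)
    (hφ : φ ∈ IsManifold.maximalAtlas (𝓡 n) ∞ M) (hK : K ⊆ φ.source) :
    ∃ v : EuclideanSpace ℝ (Fin n) × EuclideanSpace ℝ (Fin n) × ℝ → EuclideanSpace ℝ (Fin n),
      ∀ x ∈ K, ∀ x' ∈ K, ∀ t ∈ Icc (0 : ℝ) 1,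
        velocity φ G x x' t = v (φ x, φ x', t) ∧ ContDiffAt ℝ ∞ v (φ x, φ x', t) := by
  obtain ⟨U, hU, hKU, hGU⟩ := hG.smooth
  set ψ : EuclideanSpace ℝ (Fin n) × EuclideanSpace ℝ (Fin n) × ℝ → EuclideanSpace ℝ (Fin n) :=
    fun q => φ (G (φ.symm q.1, φ.symm q.2.1, q.2.2)) with hψ
  -- The witness is the time derivative of G read in the chart.
  refine ⟨fun q => fderiv ℝ ψ q (0, 0, 1), fun x hx x' hx' t ht => ?_⟩
  have hsrc : G (x, x', t) ∈ φ.source := hK (hG.mapsTo x hx x' hx' ht)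
  have hlx := φ.left_inv (hK hx)
  have hlx' := φ.left_inv (hK hx')
  have hψs : ContDiffAt ℝ ∞ ψ (φ x, φ x', t) := by
    have h1 : ContMDiffAt 𝓘(ℝ, EuclideanSpace ℝ (Fin n) × EuclideanSpace ℝ (Fin n) × ℝ)
        ((𝓡 n).prod ((𝓡 n).prod 𝓘(ℝ, ℝ))) ∞
        (fun q : EuclideanSpace ℝ (Fin n) × EuclideanSpace ℝ (Fin n) × ℝ =>
          (φ.symm q.1, φ.symm q.2.1, q.2.2)) (φ x, φ x', t) := by
      refine ContMDiffAt.prodMk ?_ (ContMDiffAt.prodMk ?_ ?_)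
      · exact ContMDiffAt.comp (g := φ.symm) (φ x, φ x', t)
          (contMDiffAt_symm_of_mem_maximalAtlas hφ (φ.map_source (hK hx)))
          contDiff_fst.contMDiff.contMDiffAt
      · exact ContMDiffAt.comp (g := φ.symm) (φ x, φ x', t)
          (contMDiffAt_symm_of_mem_maximalAtlas hφ (φ.map_source (hK hx')))
          (contDiff_fst.comp contDiff_snd).contMDiff.contMDiffAt
      · exact (contDiff_snd.comp contDiff_snd).contMDiff.contMDiffAt
    have h2 : ContMDiffAt ((𝓡 n).prod ((𝓡 n).prod 𝓘(ℝ, ℝ))) (𝓡 n) ∞ G (x, x', t) :=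
      hGU.contMDiffAt (hU.mem_nhds (hKU ⟨hx, hx', ht⟩))
    have h3 := contMDiffAt_of_mem_maximalAtlas hφ hsrc
    have h4 := (h3.comp (x, x', t) h2)
    have h5 := h4.comp_of_eq h1 (by simp only [hlx, hlx'])
    exact h5.contDiffAt
  refine ⟨?_, (hψs.fderiv_right (m := ∞) (by simp)).clm_apply contDiffAt_const⟩
  have hl : HasDerivAt (fun s : ℝ => (φ x, φ x', s)) (0, 0, 1) t :=
    (hasDerivAt_const t (φ x)).prodMk ((hasDerivAt_const t (φ x')).prodMk (hasDerivAt_id t))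
  have hd : HasDerivAt (fun s => ψ (φ x, φ x', s)) (fderiv ℝ ψ (φ x, φ x', t) (0, 0, 1)) t :=
    HasFDerivAt.comp_hasDerivAt (f := fun s : ℝ => (φ x, φ x', s)) t
      (hψs.differentiableAt (by simp)).hasFDerivAt hl
  simp only [hψ, hlx, hlx'] at hd
  exact hd.hasDerivWithinAt.derivWithin (uniqueDiffOn_Icc zero_lt_one t ht)

theorem IsGeodesicMap.exists_norm_velocity_le (hG : IsGeodesicMap cov φ K G)
    (hφ : φ ∈ IsManifold.maximalAtlas (𝓡 n) ∞ M) (hK : K ⊆ φ.source) (hKc : IsCompact K) :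
    ∃ C, ∀ x ∈ K, ∀ x' ∈ K, ∀ t ∈ Icc (0 : ℝ) 1, ‖velocity φ G x x' t‖ ≤ C := by
  obtain ⟨v, hv⟩ := hG.exists_velocity_eq hφ hK
  have hcont : ContinuousOn (fun q : M × M × ℝ => v (φ q.1, φ q.2.1, q.2.2))
      (K ×ˢ K ×ˢ Icc 0 1) := by
    rintro ⟨x, x', t⟩ ⟨hx, hx', ht⟩
    refine ContinuousAt.continuousWithinAt ?_
    have h1 : ContinuousAt (fun q : M × M × ℝ => φ q.1) (x, x', t) :=
      ContinuousAt.comp (g := φ) (φ.continuousAt (hK hx)) (by fun_prop)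
    have h2 : ContinuousAt (fun q : M × M × ℝ => φ q.2.1) (x, x', t) :=
      ContinuousAt.comp (g := φ) (f := fun q : M × M × ℝ => q.2.1)
        (φ.continuousAt (hK hx')) (by fun_prop)
    exact ContinuousAt.comp (g := v) (f := fun q : M × M × ℝ => (φ q.1, φ q.2.1, q.2.2))
      (hv x hx x' hx' t ht).2.continuousAt (h1.prodMk (h2.prodMk (by fun_prop)))
  obtain ⟨C, hC⟩ := (hKc.prod (hKc.prod isCompact_Icc)).exists_bound_of_continuousOn hcont
  refine ⟨C, fun x hx x' hx' t ht => ?_⟩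
  rw [(hv x hx x' hx' t ht).1]
  exact hC (x, x', t) ⟨hx, hx', ht⟩

theorem IsGeodesicMap.continuousOn_velocity (hG : IsGeodesicMap cov φ K G)
    (hφ : φ ∈ IsManifold.maximalAtlas (𝓡 n) ∞ M) (hK : K ⊆ φ.source) {x x' : M}
    (hx : x ∈ K) (hx' : x' ∈ K) : ContinuousOn (velocity φ G x x') (Icc 0 1) := by
  obtain ⟨v, hv⟩ := hG.exists_velocity_eq hφ hK
  have : ContinuousOn (fun t => v (φ x, φ x', t)) (Icc 0 1) := fun t ht =>
    (ContinuousAt.comp (g := v) (f := fun t => (φ x, φ x', t))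
      (hv x hx x' hx' t ht).2.continuousAt (by fun_prop)).continuousWithinAt
  exact this.congr fun t ht => (hv x hx x' hx' t ht).1

/-- The velocity is locally Lipschitz in the endpoints and zero for equal endpoints, so its value at
(x, x', t) is compared with its value at (x, x, t). Compactness of [0, 1], then of K, makes the
constant uniform. -/
theorem IsGeodesicMap.exists_norm_velocity_le_near_diagonal (hG : IsGeodesicMap cov φ K G)
    (hφ : φ ∈ IsManifold.maximalAtlas (𝓡 n) ∞ M) (hK : K ⊆ φ.source) (hKc : IsCompact K) :
    ∃ C, ∃ ε > 0, ∀ x ∈ K, ∀ x', dist x x' < ε → x' ∈ K → ∀ t ∈ Icc (0 : ℝ) 1,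
      ‖velocity φ G x x' t‖ ≤ C * ‖φ x - φ x'‖ := by
  obtain ⟨v, hv⟩ := hG.exists_velocity_eq hφ hK
  suffices hloc : ∀ x₀ ∈ K, ∃ C, ∀ᶠ q : M × M in 𝓝 (x₀, x₀), q.1 ∈ K → q.2 ∈ K →
      ∀ t ∈ Icc (0 : ℝ) 1, ‖velocity φ G q.1 q.2 t‖ ≤ C * ‖φ q.1 - φ q.2‖ by
    obtain ⟨C, ε, hε, h⟩ := exists_pos_of_eventually_diagonal hKc
      (fun q C C' hCC' h h1 h2 t ht => (h h1 h2 t ht).trans (by gcongr)) hloc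
    exact ⟨C, ε, hε, fun x hx x' hd hx' t ht => h x hx x' hd hx hx' t ht⟩
  intro x₀ hx₀
  suffices hloc : ∀ t₀ ∈ Icc (0 : ℝ) 1, ∃ C, ∀ᶠ q : (M × M) × ℝ in 𝓝 ((x₀, x₀), t₀),
      q.1.1 ∈ K → q.1.2 ∈ K → q.2 ∈ Icc (0 : ℝ) 1 →
      ‖velocity φ G q.1.1 q.1.2 q.2‖ ≤ C * ‖φ q.1.1 - φ q.1.2‖ by
    obtain ⟨C, hC⟩ := exists_forall_of_isCompact (isCompact_Icc (a := (0 : ℝ)) (b := 1))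
      (P := fun C t => ∀ᶠ q : (M × M) × ℝ in 𝓝 ((x₀, x₀), t), q.1.1 ∈ K → q.1.2 ∈ K →
        q.2 ∈ Icc (0 : ℝ) 1 → ‖velocity φ G q.1.1 q.1.2 q.2‖ ≤ C * ‖φ q.1.1 - φ q.1.2‖)
      (fun t C C' hCC' h => h.mono fun q h h1 h2 h3 =>
        (h h1 h2 h3).trans (mul_le_mul_of_nonneg_right hCC' (norm_nonneg _)))
      (fun t ht => by
        obtain ⟨C, hC⟩ := hloc t ht
        have hc : Continuous fun t : ℝ => ((x₀, x₀), t) := by fun_prop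
        exact ⟨C, (hc.tendsto t).eventually hC.eventually_nhds⟩)
    refine ⟨C, ?_⟩
    have := isCompact_Icc.eventually_forall_of_forall_eventually (x₀ := (x₀, x₀))
      (P := fun (q : M × M) t => q.1 ∈ K → q.2 ∈ K → t ∈ Icc (0 : ℝ) 1 →
        ‖velocity φ G q.1 q.2 t‖ ≤ C * ‖φ q.1 - φ q.2‖) (K := Icc (0 : ℝ) 1) hC
    filter_upwards [this] with q hq h1 h2 t ht using hq t ht h1 h2 ht
  intro t₀ ht₀
  have hcd := (hv x₀ hx₀ x₀ hx₀ t₀ ht₀).2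
  obtain ⟨L, s, hs, hL⟩ := (hcd.of_le (m := 1) (by simp)).exists_lipschitzOnWith
  refine ⟨L, ?_⟩
  have hφc := φ.continuousAt (hK hx₀)
  have c₁ : ContinuousAt (fun q : (M × M) × ℝ => (φ q.1.1, φ q.1.2, q.2)) ((x₀, x₀), t₀) :=
    (ContinuousAt.comp (g := φ) (f := fun q : (M × M) × ℝ => q.1.1) hφc (by fun_prop)).prodMk
      ((ContinuousAt.comp (g := φ) (f := fun q : (M × M) × ℝ => q.1.2) hφc (by fun_prop)).prodMk
        continuousAt_snd)
  have c₂ : ContinuousAt (fun q : (M × M) × ℝ => (φ q.1.1, φ q.1.1, q.2)) ((x₀, x₀), t₀) :=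
    (ContinuousAt.comp (g := φ) (f := fun q : (M × M) × ℝ => q.1.1) hφc (by fun_prop)).prodMk
      ((ContinuousAt.comp (g := φ) (f := fun q : (M × M) × ℝ => q.1.1) hφc (by fun_prop)).prodMk
        continuousAt_snd)
  have key : ∀ q ∈ (fun q : (M × M) × ℝ => (φ q.1.1, φ q.1.2, q.2)) ⁻¹' s ∩
      (fun q : (M × M) × ℝ => (φ q.1.1, φ q.1.1, q.2)) ⁻¹' s, q.1.1 ∈ K → q.1.2 ∈ K →
      q.2 ∈ Icc (0 : ℝ) 1 → ‖velocity φ G q.1.1 q.1.2 q.2‖ ≤ L * ‖φ q.1.1 - φ q.1.2‖ := by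
    rintro ⟨⟨x, x'⟩, t⟩ ⟨h1, h2⟩ hx hx' ht
    have h3 := hL.dist_le_mul _ h1 _ h2
    simp only at h3 hx hx' ht ⊢
    rw [← (hv x hx x' hx' t ht).1, ← (hv x hx x hx t ht).1, hG.velocity_self hφ hK hx ht,
      dist_zero_right] at h3
    refine h3.trans_eq ?_
    rw [← dist_eq_norm, dist_comm (φ x)]
    simp [Prod.dist_eq]
  exact mem_of_superset (inter_mem (c₁.preimage_mem_nhds hs) (c₂.preimage_mem_nhds hs)) key

end GeodesicVelocity

/-! ### Parallel transport in coordinates -/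

section ParallelTransport

variable {n : ℕ} {M : Type*} [MetricSpace M]
  [ChartedSpace (EuclideanSpace ℝ (Fin n)) M] [IsManifold (𝓡 n) ∞ M]
  {cov : CovariantDerivative (𝓡 n) (EuclideanSpace ℝ (Fin n))
      (fun x : M => TangentSpace (𝓡 n) x)}
  {φ : OpenPartialHomeomorph M (EuclideanSpace ℝ (Fin n))} {K : Set M} {G : M × M × ℝ → M}

theorem IsGeodesicMap.isParallelAlong_iff (hG : IsGeodesicMap cov φ K G)
    (hφ : φ ∈ IsManifold.maximalAtlas (𝓡 n) ∞ M) (hK : K ⊆ φ.source) {x x' : M}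
    (hx : x ∈ K) (hx' : x' ∈ K) (w : ℝ → EuclideanSpace ℝ (Fin n)) :
    IsParallelAlong cov φ (fun t => G (x, x', t)) w ↔ ∀ t ∈ Icc (0 : ℝ) 1, HasDerivWithinAt w
      (-christoffelCLM cov φ (φ (G (x, x', t))) (velocity φ G x x' t) (w t)) (Icc 0 1) t := by
  refine forall₂_congr fun t ht => ?_
  rw [christoffelCLM_apply cov hφ (φ.map_source (hK (hG.mapsTo x hx x' hx' ht)))]
  rfl

variable [CovariantDerivative.ContMDiffCovariantDerivative cov ∞]

theorem continuousOn_christoffelCLM (hφ : φ ∈ IsManifold.maximalAtlas (𝓡 n) ∞ M) :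
    ContinuousOn (fun x => christoffelCLM cov φ (φ x)) φ.source := fun _ hx =>
  (ContinuousAt.comp (g := christoffelCLM cov φ)
    (contDiffAt_christoffelCLM cov hφ (φ.map_source hx)).continuousAt
    (φ.continuousAt hx)).continuousWithinAt

set_option synthInstance.maxHeartbeats 200000 in
theorem exists_norm_christoffelCLM_le (hφ : φ ∈ IsManifold.maximalAtlas (𝓡 n) ∞ M)
    (hK : K ⊆ φ.source) (hKc : IsCompact K) :
    ∃ C, 0 ≤ C ∧ ∀ x ∈ K, ‖christoffelCLM cov φ (φ x)‖ ≤ C := by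
  obtain ⟨C, hC⟩ := hKc.exists_bound_of_continuousOn
    (E := EuclideanSpace ℝ (Fin n) →L[ℝ] EuclideanSpace ℝ (Fin n) →L[ℝ] EuclideanSpace ℝ (Fin n))
    ((continuousOn_christoffelCLM (cov := cov) hφ).mono hK)
  exact ⟨max C 0, le_max_right _ _, fun x hx => (hC x hx).trans (le_max_left _ _)⟩

/-- Grönwall bounds any parallel field. Existence of one is not needed: otherwise the transport is 0
by definition and the bound is trivial. -/
theorem IsGeodesicMap.exists_norm_parallelTransport_le (hG : IsGeodesicMap cov φ K G)
    (hφ : φ ∈ IsManifold.maximalAtlas (𝓡 n) ∞ M) (hK : K ⊆ φ.source) (hKc : IsCompact K) :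
    ∃ C, 0 ≤ C ∧ ∀ x ∈ K, ∀ x' ∈ K, ∀ z : TangentSpace (𝓡 n) x,
      ‖comp φ x' (parallelTransport cov φ (fun t => G (x, x', t)) x x' z)‖
        ≤ C * ‖comp φ x z‖ := by
  obtain ⟨C₁, hC₁⟩ := hG.exists_norm_velocity_le hφ hK hKc
  obtain ⟨C₂, hC₂, hΓ⟩ := exists_norm_christoffelCLM_le (cov := cov) hφ hK hKc
  refine ⟨Real.exp (C₂ * C₁), by positivity, fun x hx x' hx' z => ?_⟩
  unfold parallelTransport
  split_ifs with h
  · rw [comp_coordField hφ (hK hx')]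
    have hs := h.choose_spec
    set w := h.choose
    have hw := (hG.isParallelAlong_iff hφ hK hx hx' w).1 hs.1
    have := norm_le_exp_of_linear_ode (c := C₂ * C₁)
      (A := fun t u => christoffelCLM cov φ (φ (G (x, x', t))) (velocity φ G x x' t) u)
      (fun t ht => ContinuousLinearMap.le_of_opNorm_le _
        ((ContinuousLinearMap.le_opNorm _ _).trans (mul_le_mul
          (hΓ _ (hG.mapsTo x hx x' hx' ht)) (hC₁ x hx x' hx' t ht) (norm_nonneg _) hC₂)) _)
      hw 1 (right_mem_Icc.2 zero_le_one)
    rw [hs.2, mul_one, mul_comm] at this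
    exact this
  · have : comp φ x' (0 : TangentSpace (𝓡 n) x') = 0 :=
      map_zero (mfderiv (𝓡 n) 𝓘(ℝ, EuclideanSpace ℝ (Fin n)) φ x')
    rw [this, norm_zero]
    positivity

/-- The coefficient of the transport equation is controlled by the velocity, hence by ‖φ x - φ x'‖,
and so is the displacement of a solution over unit time. -/
theorem IsGeodesicMap.exists_norm_parallelTransport_sub_le (hG : IsGeodesicMap cov φ K G)
    (hφ : φ ∈ IsManifold.maximalAtlas (𝓡 n) ∞ M) (hK : K ⊆ φ.source) (hKc : IsCompact K) :
    ∃ C, ∃ ε > 0, ∀ x ∈ K, ∀ x', dist x x' < ε → x' ∈ K → ∀ z : TangentSpace (𝓡 n) x,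
      ‖comp φ x' (parallelTransport cov φ (fun t => G (x, x', t)) x x' z) - comp φ x z‖
        ≤ C * ‖φ x - φ x'‖ * ‖comp φ x z‖ := by
  obtain ⟨C₁', ε₁, hε₁, hC₁'⟩ := hG.exists_norm_velocity_le_near_diagonal hφ hK hKc
  obtain ⟨C₁, hC₁0, hC₁⟩ : ∃ C₁, 0 ≤ C₁ ∧ ∀ x ∈ K, ∀ x', dist x x' < ε₁ → x' ∈ K →
      ∀ t ∈ Icc (0 : ℝ) 1, ‖velocity φ G x x' t‖ ≤ C₁ * ‖φ x - φ x'‖ :=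
    ⟨max C₁' 0, le_max_right _ _, fun x hx x' hd hx' t ht =>
      (hC₁' x hx x' hd hx' t ht).trans (by gcongr; exact le_max_left _ _)⟩
  obtain ⟨C₂, hC₂, hΓ⟩ := exists_norm_christoffelCLM_le (cov := cov) hφ hK hKc
  -- near the diagonal, the coefficient of the equation of parallel transport is small
  obtain ⟨-, ε₂, hε₂, hsmall⟩ := exists_pos_of_eventually_diagonal hKc
    (P := fun (_ : ℝ) (q : M × M) => C₂ * (C₁ * ‖φ q.1 - φ q.2‖) < 1 / 2) (fun _ _ _ _ h => h) (fun x hx => by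
      refine ⟨0, ?_⟩
      have hφc := φ.continuousAt (hK hx)
      have hc : ContinuousAt (fun q : M × M => C₂ * (C₁ * ‖φ q.1 - φ q.2‖)) (x, x) := by
        have h1 : ContinuousAt (fun q : M × M => φ q.1) (x, x) :=
          ContinuousAt.comp (g := φ) hφc continuousAt_fst
        have h2 : ContinuousAt (fun q : M × M => φ q.2) (x, x) :=
          ContinuousAt.comp (g := φ) hφc continuousAt_snd
        exact continuousAt_const.mul (continuousAt_const.mul (h1.sub h2).norm)
      exact hc.eventually_lt_const (by simp))
  refine ⟨C₂ * C₁ * Real.exp 1, min ε₁ ε₂, lt_min hε₁ hε₂, fun x hx x' hd hx' z => ?_⟩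
  have hv := hC₁ x hx x' (hd.trans_le (min_le_left _ _)) hx'
  have hs := hsmall x hx x' (hd.trans_le (min_le_right _ _))
  simp only at hs
  have hA : ∀ t ∈ Icc (0 : ℝ) 1,
      ‖christoffelCLM cov φ (φ (G (x, x', t))) (velocity φ G x x' t)‖
        ≤ C₂ * (C₁ * ‖φ x - φ x'‖) := fun t ht =>
    (ContinuousLinearMap.le_opNorm _ _).trans
      (mul_le_mul (hΓ _ (hG.mapsTo x hx x' hx' ht)) (hv t ht) (norm_nonneg _) hC₂)
  have hcontG : ContinuousOn (fun t => G (x, x', t)) (Icc 0 1) := by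
    obtain ⟨U, hU, hKU, hGU⟩ := hG.smooth
    exact hGU.continuousOn.comp (by fun_prop) fun t ht => hKU ⟨hx, hx', ht⟩
  have hcont : ContinuousOn
      (fun t => christoffelCLM cov φ (φ (G (x, x', t))) (velocity φ G x x' t)) (Icc 0 1) :=
    (((continuousOn_christoffelCLM hφ).mono hK).comp hcontG
      (hG.mapsTo x hx x' hx')).clm_apply (hG.continuousOn_velocity hφ hK hx hx')
  -- Here existence matters, since the default value 0 would not be close to z.
  have hex : ∃ w, IsParallelAlong cov φ (fun t => G (x, x', t)) w ∧ w 0 = comp φ x z := by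
    obtain ⟨w, h0, hw⟩ := exists_solution_of_linear_ode hcont
      (fun t ht => (hA t ht).trans hs.le) (comp φ x z)
    exact ⟨w, (hG.isParallelAlong_iff hφ hK hx hx' w).2 hw, h0⟩
  unfold parallelTransport
  rw [dif_pos hex, comp_coordField hφ (hK hx')]
  have hspec := hex.choose_spec
  set w := hex.choose
  have hw := (hG.isParallelAlong_iff hφ hK hx hx' w).1 hspec.1
  have h0 : 0 ≤ C₂ * (C₁ * ‖φ x - φ x'‖) := by positivity
  have := norm_sub_le_of_linear_ode h0
    (A := fun t u => christoffelCLM cov φ (φ (G (x, x', t))) (velocity φ G x x' t) u)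
    (fun t ht => ContinuousLinearMap.le_of_opNorm_le _ (hA t ht) _) hw
  rw [hspec.2] at this
  calc ‖w 1 - comp φ x z‖
      ≤ C₂ * (C₁ * ‖φ x - φ x'‖) *
        (‖comp φ x z‖ * Real.exp (C₂ * (C₁ * ‖φ x - φ x'‖))) := this
    _ ≤ C₂ * (C₁ * ‖φ x - φ x'‖) * (‖comp φ x z‖ * Real.exp 1) := by
      gcongr
      linarith
    _ = _ := by ring

end ParallelTransport


/-! ### Splitting the Hessian into transversal and diagonal parts -/

section HessianAlgebra

variable {E : Type*} [NormedAddCommGroup E] [NormedSpace ℝ E]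

/-- The form `D₂ - D₁ ∘ Γ̄` on the vector with components `(a, b)` in the coordinates
`(y - y', y')`, compared with its value on `(a, 0)`. -/
theorem le_hessian_form_of_bounds (D₂ : E × E →L[ℝ] E × E →L[ℝ] ℝ) (D₁ : E × E →L[ℝ] ℝ)
    (Γ Γ' : E →L[ℝ] E →L[ℝ] E) {C B L r s : ℝ} (hC : 0 ≤ C) (hr : 0 ≤ r) (hs : 0 ≤ s)
    (hΓ : ‖Γ‖ ≤ B) (hΓ' : ‖Γ'‖ ≤ B) (hΓΓ' : ‖Γ - Γ'‖ ≤ L * s)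
    (hD : ∀ a b : E, |D₂ (a, 0) (b, b)| ≤ C * r * (‖a‖ * ‖b‖) ∧
      |D₂ (b, b) (a, 0)| ≤ C * r * (‖a‖ * ‖b‖) ∧ |D₂ (b, b) (b, b)| ≤ C * (r * s) * ‖b‖ ^ 2 ∧
      |D₁ (a, 0)| ≤ C * r * ‖a‖ ∧ |D₁ (b, b)| ≤ C * (r * s) * ‖b‖) (a b : E) :
    D₂ (a, 0) (a, 0) - D₁ (Γ a a, 0) - C * (2 + 2 * B) * r * (‖a‖ * ‖b‖)
        - C * (1 + L + B) * (r * s) * ‖b‖ ^ 2 ≤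
      D₂ (a + b, b) (a + b, b) - D₁ (Γ (a + b) (a + b), Γ' b b) := by
  obtain ⟨h1, h2, h3, -, -⟩ := hD a b
  have hsplit : ((a + b, b) : E × E) = (a, 0) + (b, b) := by simp
  have hD₂ : D₂ (a + b, b) (a + b, b) = D₂ (a, 0) (a, 0) + D₂ (a, 0) (b, b) + D₂ (b, b) (a, 0)
      + D₂ (b, b) (b, b) := by
    rw [hsplit]
    simp only [map_add, add_apply]
    ring
  -- The term (Γ b b, Γ' b b) is written as ((Γ - Γ') b b, 0), transversal but with small
  -- coefficient, plus the diagonal vector (Γ' b b, Γ' b b).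
  have hD₁ : D₁ (Γ (a + b) (a + b), Γ' b b) = D₁ (Γ a a, 0) + D₁ (Γ a b, 0) + D₁ (Γ b a, 0)
      + D₁ ((Γ - Γ') b b, 0) + D₁ (Γ' b b, Γ' b b) := by
    rw [← map_add, ← map_add, ← map_add, ← map_add]
    congr 1
    simp only [Prod.mk_add_mk, map_add, add_apply,
      sub_apply, zero_add]
    congr 1
    abel
  have hCr : 0 ≤ C * r := mul_nonneg hC hr
  have hab : |D₁ (Γ a b, 0)| ≤ C * r * (B * ‖a‖ * ‖b‖) :=
    (hD _ 0).2.2.2.1.trans (mul_le_mul_of_nonneg_left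
      (Γ.le_of_opNorm₂_le_of_le hΓ le_rfl le_rfl) hCr)
  have hba : |D₁ (Γ b a, 0)| ≤ C * r * (B * ‖b‖ * ‖a‖) :=
    (hD _ 0).2.2.2.1.trans (mul_le_mul_of_nonneg_left
      (Γ.le_of_opNorm₂_le_of_le hΓ le_rfl le_rfl) hCr)
  have hbb : |D₁ ((Γ - Γ') b b, 0)| ≤ C * r * (L * s * ‖b‖ * ‖b‖) :=
    (hD _ 0).2.2.2.1.trans (mul_le_mul_of_nonneg_left
      ((Γ - Γ').le_of_opNorm₂_le_of_le hΓΓ' le_rfl le_rfl) hCr)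
  have hbb' : |D₁ (Γ' b b, Γ' b b)| ≤ C * (r * s) * (B * ‖b‖ * ‖b‖) :=
    (hD 0 _).2.2.2.2.trans (mul_le_mul_of_nonneg_left
      (Γ'.le_of_opNorm₂_le_of_le hΓ' le_rfl le_rfl) (by positivity))
  rw [hD₂, hD₁]
  linarith [(abs_le.1 h1).1, (abs_le.1 h2).1, (abs_le.1 h3).1, (abs_le.1 hab).2, (abs_le.1 hba).2,
    (abs_le.1 hbb).2, (abs_le.1 hbb').2]

theorem exists_norm_sub_le_of_contDiffAt {F : Type*} [NormedAddCommGroup F] [NormedSpace ℝ F]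
    {f : E → F} {y₀ : E} (hf : ContDiffAt ℝ ∞ f y₀) :
    ∃ L, 0 ≤ L ∧ ∀ᶠ q in 𝓝 (y₀, y₀), ‖f q.1 - f q.2‖ ≤ L * ‖q.1 - q.2‖ := by
  obtain ⟨L, t, ht, hL⟩ := (hf.of_le (m := 1) (by simp)).exists_lipschitzOnWith
  refine ⟨L, L.2, ?_⟩
  filter_upwards [prod_mem_nhds ht ht] with q hq using hL.norm_sub_le hq.1 hq.2

end HessianAlgebra

/-! ### Real and integer powers -/

section Powers

/-- This includes x = 0 with p = 2, where x ^ (p - 2) = 1: the exponent p - 1 is nonzero, which is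
all that is needed. -/
theorem rpow_sub_one_eq_mul {x p : ℝ} (hx : 0 ≤ x) (hp : 2 ≤ p) :
    x ^ (p - 1) = x ^ (p - 2) * x := by
  rw [← Real.rpow_add_one' hx (by linarith)]
  ring_nf

theorem rpow_eq_mul_sq {x p : ℝ} (hx : 0 ≤ x) (hp : 2 ≤ p) : x ^ p = x ^ (p - 2) * x ^ 2 := by
  rw [sq, ← mul_assoc, ← rpow_sub_one_eq_mul hx hp, ← Real.rpow_add_one' hx (by linarith)]
  ring_nf

/-- Trades the integer orders m and m - 1, with m = ⌈p⌉, for p and p - 1: lowering an exponent is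
harmless for distances at most 1. -/
theorem pow_le_mul_rpow {s C x q : ℝ} {k : ℕ} (hs : 0 ≤ s) (hC : 0 ≤ C) (hx : 0 ≤ x) (hx1 : x ≤ 1)
    (hsx : s ≤ C * x) (hq : 0 ≤ q) (hqk : q ≤ k) : s ^ k ≤ C ^ k * x ^ q :=
  calc s ^ k ≤ (C * x) ^ k := pow_le_pow_left₀ hs hsx k
    _ = C ^ k * x ^ (k : ℝ) := by rw [mul_pow, Real.rpow_natCast]
    _ ≤ C ^ k * x ^ q :=
        mul_le_mul_of_nonneg_left (Real.rpow_le_rpow_of_exponent_ge' hx hx1 hq hqk)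
          (pow_nonneg hC k)

end Powers

/-! ### Smoothness of Ψ in the chart -/

section Chart

variable {n : ℕ} {M : Type*} [TopologicalSpace M] {φ : OpenPartialHomeomorph M (EuclideanSpace ℝ (Fin n))}
  {Ψ : M × M → ℝ} {W : Set (M × M)}

theorem contDiffOn_inChart [ChartedSpace (EuclideanSpace ℝ (Fin n)) M]
    (hφ : φ ∈ IsManifold.maximalAtlas (𝓡 n) ∞ M)
    (hΨ : ContMDiffOn ((𝓡 n).prod (𝓡 n)) 𝓘(ℝ, ℝ) ∞ Ψ W) :
    ContDiffOn ℝ ∞ (inChart φ Ψ) ((φ.prod φ).target ∩ (φ.prod φ).symm ⁻¹' W) := by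
  rw [← contMDiffOn_iff_contDiffOn]
  have hs := contMDiffOn_symm_of_mem_maximalAtlas hφ
  exact hΨ.comp
    ((hs.comp contDiff_fst.contMDiff.contMDiffOn fun y hy => hy.1.1).prodMk
      (hs.comp contDiff_snd.contMDiff.contMDiffOn fun y hy => hy.1.2)) fun y hy => hy.2

theorem mk_mem_prod_target {x x' : M} (hx : x ∈ φ.source) (hx' : x' ∈ φ.source)
    (h : (x, x') ∈ W) : (φ x, φ x') ∈ (φ.prod φ).target ∩ (φ.prod φ).symm ⁻¹' W := by
  refine ⟨⟨φ.map_source hx, φ.map_source hx'⟩, ?_⟩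
  simpa [φ.left_inv hx, φ.left_inv hx'] using h

end Chart


/-! ### Bounds for the Hessian of Ψ -/

section HessianBounds

variable {n : ℕ} {M : Type*} [MetricSpace M]
  [ChartedSpace (EuclideanSpace ℝ (Fin n)) M] [IsManifold (𝓡 n) ∞ M]
  {cov : CovariantDerivative (𝓡 n) (EuclideanSpace ℝ (Fin n))
      (fun x : M => TangentSpace (𝓡 n) x)}
  [CovariantDerivative.ContMDiffCovariantDerivative cov ∞]
  {φ : OpenPartialHomeomorph M (EuclideanSpace ℝ (Fin n))} {K : Set M}
  {Ψ : M × M → ℝ} {W : Set (M × M)}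

/-- Continuity of the derivatives and symbols on a compact set; this crude bound serves away from
the diagonal. -/
theorem exists_abs_hessCoord_le (hφ : φ ∈ IsManifold.maximalAtlas (𝓡 n) ∞ M)
    (hK : K ⊆ φ.source) (hKc : IsCompact K) (hW : IsOpen W) (hKW : K ×ˢ K ⊆ W)
    (hΨ : ContMDiffOn ((𝓡 n).prod (𝓡 n)) 𝓘(ℝ, ℝ) ∞ Ψ W) :
    ∃ C, 0 ≤ C ∧ ∀ x ∈ K, ∀ x' ∈ K, ∀ u v : EuclideanSpace ℝ (Fin n),
      |hessCoord cov φ Ψ x x' (u, v) (u, v)| ≤ C * (‖u‖ ^ 2 + ‖v‖ ^ 2) := by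
  obtain ⟨B, hB0, hB⟩ := exists_norm_christoffelCLM_le (cov := cov) hφ hK hKc
  have hF := contDiffOn_inChart hφ hΨ
  have hV := (φ.prod φ).symm.isOpen_inter_preimage hW
  have hF' := hF.fderiv_of_isOpen (m := ∞) hV (by simp)
  have hF'' := hF'.fderiv_of_isOpen (m := ∞) hV (by simp)
  have hφK : ContinuousOn (fun q : M × M => (φ q.1, φ q.2)) (K ×ˢ K) :=
    ((φ.continuousOn.mono hK).comp continuousOn_fst fun q hq => hq.1).prodMk
      ((φ.continuousOn.mono hK).comp continuousOn_snd fun q hq => hq.2)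
  have hmaps : MapsTo (fun q : M × M => (φ q.1, φ q.2)) (K ×ˢ K)
      ((φ.prod φ).target ∩ (φ.prod φ).symm ⁻¹' W) := fun q hq =>
    mk_mem_prod_target (hK hq.1) (hK hq.2) (hKW hq)
  obtain ⟨C₁, hC₁⟩ := (hKc.prod hKc).exists_bound_of_continuousOn (hF'.continuousOn.comp hφK hmaps)
  obtain ⟨C₂, hC₂⟩ := (hKc.prod hKc).exists_bound_of_continuousOn
    (hF''.continuousOn.comp hφK hmaps)
  refine ⟨max C₂ 0 + max C₁ 0 * B, by positivity, fun x hx x' hx' u v => ?_⟩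
  have h1 := (hC₁ (x, x') ⟨hx, hx'⟩).trans (le_max_left _ 0)
  have h2 := (hC₂ (x, x') ⟨hx, hx'⟩).trans (le_max_left _ 0)
  have hsq : ∀ t, t = ‖u‖ ∨ t = ‖v‖ → t * t ≤ ‖u‖ ^ 2 + ‖v‖ ^ 2 := by
    rintro t (rfl | rfl) <;> nlinarith [sq_nonneg ‖u‖, sq_nonneg ‖v‖]
  have hmax : ‖(u, v)‖ * ‖(u, v)‖ ≤ ‖u‖ ^ 2 + ‖v‖ ^ 2 := hsq _ (max_choice _ _)
  have hΓ : ‖prodChristoffel cov φ (φ x, φ x') (u, v) (u, v)‖ ≤ B * (‖u‖ ^ 2 + ‖v‖ ^ 2) := by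
    simp only [prodChristoffel]
    rw [← christoffelCLM_apply cov hφ (φ.map_source (hK hx)),
      ← christoffelCLM_apply cov hφ (φ.map_source (hK hx'))]
    refine max_le ?_ ?_
    · refine ((christoffelCLM cov φ (φ x)).le_of_opNorm₂_le_of_le (hB x hx) le_rfl le_rfl).trans ?_
      rw [mul_assoc]
      exact mul_le_mul_of_nonneg_left (hsq _ (.inl rfl)) hB0
    · refine ((christoffelCLM cov φ (φ x')).le_of_opNorm₂_le_of_le (hB x' hx') le_rfl
        le_rfl).trans ?_
      rw [mul_assoc]
      exact mul_le_mul_of_nonneg_left (hsq _ (.inr rfl)) hB0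
  unfold hessCoord
  refine (abs_sub _ _).trans ?_
  rw [add_mul, mul_assoc]
  refine add_le_add ?_ ?_
  · refine (ContinuousLinearMap.le_of_opNorm₂_le_of_le _ h2 le_rfl le_rfl).trans ?_
    rw [mul_assoc]
    exact mul_le_mul_of_nonneg_left hmax (le_max_right _ _)
  · exact ContinuousLinearMap.le_of_opNorm_le_of_le _ h1 hΓ

/-- Combines the orders of vanishing on the diagonal with the Lipschitz bound for the Christoffel
symbols, at each point of `closure D`, then uniformly by compactness. -/
theorem exists_le_hessCoord_near_diagonal
    [RiemannianBundle (fun x : M => TangentSpace (𝓡 n) x)]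
    [IsContMDiffRiemannianBundle (𝓡 n) ∞ (EuclideanSpace ℝ (Fin n))
      (fun x : M => TangentSpace (𝓡 n) x)]
    [IsRiemannianManifold (𝓡 n) M]
    (hφ : φ ∈ IsManifold.maximalAtlas (𝓡 n) ∞ M) {D : Set M} (hD : IsOpen D)
    (hDφ : closure D ⊆ φ.source) (hDc : IsCompact (closure D)) (hW : IsOpen W)
    (hDW : closure D ×ˢ closure D ⊆ W)
    (hΨ : ContMDiffOn ((𝓡 n).prod (𝓡 n)) 𝓘(ℝ, ℝ) ∞ Ψ W) {p C₀ : ℝ} (hp : 2 ≤ p)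
    (hΨp : ∀ x ∈ closure D, ∀ x' ∈ closure D, |Ψ (x, x')| ≤ C₀ * dist x x' ^ p) :
    ∃ C, ∃ ε > 0, ∀ x ∈ closure D, ∀ x', dist x x' < ε → x' ∈ closure D →
      ∀ a b : EuclideanSpace ℝ (Fin n),
      blockA cov φ Ψ x x' a
        - C * (dist x x' ^ (p - 1) * (‖a‖ * ‖b‖) + dist x x' ^ p * ‖b‖ ^ 2)
        ≤ hessCoord cov φ Ψ x x' (a + b, b) (a + b, b) := by
  have := isContinuousRiemannianBundle (M := M) (n := n)
  obtain ⟨B, hB0, hB⟩ := exists_norm_christoffelCLM_le (cov := cov) hφ hDφ hDc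
  have hF := contDiffOn_inChart hφ hΨ
  have hV := (φ.prod φ).symm.isOpen_inter_preimage hW
  have hDs : D ⊆ φ.source := subset_closure.trans hDφ
  have hD' : IsOpen (φ '' D) := φ.isOpen_image_of_subset_source hD hDs
  -- As D is open, the displaced point stays in D for small u, so the upper bound on Ψ applies; the
  -- distance is then at most a multiple of ‖u‖.
  have hO : ∀ y ∈ φ '' D, (fun u => inChart φ Ψ (y + u, y)) =O[𝓝 0] fun u => ‖u‖ ^ p := by
    rintro _ ⟨x₀, hx₀, rfl⟩
    obtain ⟨C, hC, h⟩ := exists_dist_le_norm_sub hφ (hDs hx₀)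
    have hc : Tendsto (fun u => φ.symm (φ x₀ + u)) (𝓝 0) (𝓝 x₀) := by
      have h1 := (φ.continuousAt_symm (φ.map_source (hDs hx₀))).tendsto
      rw [φ.left_inv (hDs hx₀)] at h1
      refine h1.comp ?_
      have : Continuous fun u => φ x₀ + u := by fun_prop
      simpa using this.tendsto 0
    have ht : ∀ᶠ u in 𝓝 0, φ x₀ + u ∈ φ.target := by
      have : Continuous fun u => φ x₀ + u := by fun_prop
      refine this.continuousAt.eventually_mem (φ.open_target.mem_nhds ?_)
      simpa using φ.map_source (hDs hx₀)
    refine Asymptotics.IsBigO.of_bound (|C₀| * C ^ p) ?_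
    filter_upwards [hc.eventually h, hc.eventually_mem (hD.mem_nhds hx₀), ht] with u h1 h2 h3
    rw [φ.right_inv h3, add_sub_cancel_left] at h1
    simp only [inChart, φ.left_inv (hDs hx₀)]
    rw [Real.norm_eq_abs, Real.norm_eq_abs, abs_of_nonneg (a := ‖u‖ ^ p) (by positivity)]
    refine (hΨp _ (subset_closure h2) _ (subset_closure hx₀)).trans ?_
    rw [mul_assoc, ← Real.mul_rpow hC (norm_nonneg _)]
    exact mul_le_mul (le_abs_self _)
      (Real.rpow_le_rpow dist_nonneg h1 (by linarith)) (by positivity) (abs_nonneg _)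
  suffices hloc : ∀ x₀ ∈ closure D, ∃ C, ∀ᶠ q : M × M in 𝓝 (x₀, x₀), q.1 ∈ closure D →
      q.2 ∈ closure D → ∀ a b : EuclideanSpace ℝ (Fin n), blockA cov φ Ψ q.1 q.2 a
        - C * (dist q.1 q.2 ^ (p - 1) * (‖a‖ * ‖b‖) + dist q.1 q.2 ^ p * ‖b‖ ^ 2)
        ≤ hessCoord cov φ Ψ q.1 q.2 (a + b, b) (a + b, b) by
    obtain ⟨C, ε, hε, h⟩ := exists_pos_of_eventually_diagonal hDc
      (P := fun C q => q.1 ∈ closure D → q.2 ∈ closure D → ∀ a b : EuclideanSpace ℝ (Fin n),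
        blockA cov φ Ψ q.1 q.2 a
        - C * (dist q.1 q.2 ^ (p - 1) * (‖a‖ * ‖b‖) + dist q.1 q.2 ^ p * ‖b‖ ^ 2)
        ≤ hessCoord cov φ Ψ q.1 q.2 (a + b, b) (a + b, b))
      (fun q C C' hCC' h h1 h2 a b => le_trans
        (sub_le_sub_left (mul_le_mul_of_nonneg_right hCC' (by positivity)) _) (h h1 h2 a b)) hloc
    exact ⟨C, ε, hε, fun x hx x' hd hx' => h x hx x' hd hx hx'⟩
  intro x₀ hx₀
  -- m = ⌈p⌉: every integer below m is below p, so those derivatives vanish, while m ≥ p recovers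
  -- the full power of the distance.
  obtain ⟨m, hpm, hmp⟩ : ∃ m : ℕ, p ≤ m ∧ m < p + 1 :=
    ⟨⌈p⌉₊, Nat.le_ceil p, Nat.ceil_lt_add_one (by linarith)⟩
  have hm1 : 1 ≤ m := by
    have : (1 : ℝ) ≤ m := by linarith
    exact_mod_cast this
  have hφc := φ.continuousAt (hDφ hx₀)
  have hφ₁ : ContinuousAt (fun q : M × M => φ q.1) (x₀, x₀) :=
    ContinuousAt.comp (g := φ) hφc continuousAt_fst
  have hφ₂ : ContinuousAt (fun q : M × M => φ q.2) (x₀, x₀) :=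
    ContinuousAt.comp (g := φ) hφc continuousAt_snd
  obtain ⟨C₁, hC₁, h₁⟩ := exists_diagonal_estimates hD' hV hF
    (by
      rintro _ ⟨x, hx, rfl⟩
      exact mk_mem_prod_target (hDs hx) (hDs hx) (hDW ⟨subset_closure hx, subset_closure hx⟩))
    hmp hm1 hO (mk_mem_prod_target (hDφ hx₀) (hDφ hx₀) (hDW ⟨hx₀, hx₀⟩))
  obtain ⟨C₂, hC₂, h₂⟩ := exists_norm_sub_le_dist hφ (hDφ hx₀)
  obtain ⟨L, hL, h₃⟩ := exists_norm_sub_le_of_contDiffAt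
    (contDiffAt_christoffelCLM cov hφ (φ.map_source (hDφ hx₀)))
  refine ⟨max (C₁ * (2 + 2 * B) * C₂ ^ (m - 1)) (C₁ * (1 + L + B) * C₂ ^ m), ?_⟩
  have hdist : ∀ᶠ q : M × M in 𝓝 (x₀, x₀), dist q.1 q.2 ≤ 1 := by
    have : Continuous fun q : M × M => dist q.1 q.2 := by fun_prop
    exact (this.continuousAt.eventually_lt_const (by simp)).mono fun q hq => le_of_lt hq
  filter_upwards [(hφ₁.prodMk hφ₂).eventually h₁, h₂,
    (hφ₁.prodMk hφ₂).eventually h₃, hdist] with q hq₁ hq₂ ht₁ hd hx hx' a b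
  have hcl : φ q.2 ∈ closure (φ '' D) :=
    (φ.continuousOn.mono hDφ).image_closure ⟨q.2, hx', rfl⟩
  have hs := norm_nonneg (φ q.1 - φ q.2)
  have key := le_hessian_form_of_bounds
    (fderiv ℝ (fderiv ℝ (inChart φ Ψ)) (φ q.1, φ q.2)) (fderiv ℝ (inChart φ Ψ) (φ q.1, φ q.2))
    (christoffelCLM cov φ (φ q.1)) (christoffelCLM cov φ (φ q.2)) hC₁
    (pow_nonneg hs (m - 1)) hs (hB _ hx) (hB _ hx')
    ht₁
    (by
      rw [← pow_succ, Nat.sub_add_cancel hm1]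
      exact hq₁ hcl) a b
  rw [← pow_succ, Nat.sub_add_cancel hm1] at key
  simp only [blockA, hessV, hessCoord, prodChristoffel, add_zero,
    ← christoffelCLM_apply cov hφ (φ.map_source (hDφ hx)),
    ← christoffelCLM_apply cov hφ (φ.map_source (hDφ hx')), map_zero]
  refine le_trans ?_ key
  have e₁ : ‖φ q.1 - φ q.2‖ ^ (m - 1) ≤ C₂ ^ (m - 1) * dist q.1 q.2 ^ (p - 1) :=
    pow_le_mul_rpow hs hC₂ dist_nonneg hd hq₂ (by linarith) (by
      rw [Nat.cast_sub hm1]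
      push_cast
      linarith)
  have e₂ : ‖φ q.1 - φ q.2‖ ^ m ≤ C₂ ^ m * dist q.1 q.2 ^ p :=
    pow_le_mul_rpow hs hC₂ dist_nonneg hd hq₂ (by linarith) hpm
  rw [sub_sub (_ - _), mul_add]
  apply sub_le_sub_left
  apply add_le_add
  · calc C₁ * (2 + 2 * B) * ‖φ q.1 - φ q.2‖ ^ (m - 1) * (‖a‖ * ‖b‖)
        ≤ C₁ * (2 + 2 * B) * (C₂ ^ (m - 1) * dist q.1 q.2 ^ (p - 1)) * (‖a‖ * ‖b‖) := by gcongr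
      _ = C₁ * (2 + 2 * B) * C₂ ^ (m - 1) * (dist q.1 q.2 ^ (p - 1) * (‖a‖ * ‖b‖)) := by ring
      _ ≤ _ := mul_le_mul_of_nonneg_right (le_max_left _ _) (by positivity)
  · calc C₁ * (1 + L + B) * ‖φ q.1 - φ q.2‖ ^ m * ‖b‖ ^ 2
        ≤ C₁ * (1 + L + B) * (C₂ ^ m * dist q.1 q.2 ^ p) * ‖b‖ ^ 2 := by gcongr
      _ = C₁ * (1 + L + B) * C₂ ^ m * (dist q.1 q.2 ^ p * ‖b‖ ^ 2) := by ring
      _ ≤ _ := mul_le_mul_of_nonneg_right (le_max_right _ _) (by positivity)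

end HessianBounds


/-! ### Scalar inequalities -/

section RealInequalities

/-- Completing the square: the difference of the two sides is lam (η / 2) (a - H d b / η)². It is
applied with lam = d ^ (p - 2). -/
theorem half_le_sub_of_mul {lam d η H a b : ℝ} (hlam : 0 ≤ lam) (hη : 0 < η) :
    η / 2 * lam * a ^ 2 - (H ^ 2 / (2 * η) + H) * (lam * d ^ 2) * b ^ 2 ≤
      η * lam * a ^ 2 - H * (lam * d * (a * b) + lam * d ^ 2 * b ^ 2) := by
  have h : η * lam * a ^ 2 - H * (lam * d * (a * b) + lam * d ^ 2 * b ^ 2)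
      - (η / 2 * lam * a ^ 2 - (H ^ 2 / (2 * η) + H) * (lam * d ^ 2) * b ^ 2)
      = lam * (η / 2) * (a - H * d * b / η) ^ 2 := by
    field_simp
    ring
  have : 0 ≤ lam * (η / 2) * (a - H * d * b / η) ^ 2 := by positivity
  linarith

theorem sq_le_two_mul_of_le_add {t N u v : ℝ} (ht : 0 ≤ t) (h : t ≤ N * (u + v)) :
    t ^ 2 ≤ 2 * N ^ 2 * (u ^ 2 + v ^ 2) := by
  have h1 : t ^ 2 ≤ (N * (u + v)) ^ 2 := pow_le_pow_left₀ ht h 2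
  nlinarith [mul_nonneg (sq_nonneg N) (sq_nonneg (u - v))]

/-- The square of the bound on τ splits into an a² part, which α is small enough to fit under η / 2,
and a d² u² part, which turns d ^ (p - 2) into d ^ p ≤ C ψ. -/
theorem mul_sq_le_of_le_add_near {d p η α N T C ψ h τ u a b z z' : ℝ} (hd : 0 ≤ d) (hp : 2 ≤ p)
    (hα : 0 ≤ α) (hαN : α * (2 * N ^ 2) ≤ η / 2) (hh : 0 ≤ h) (hC : 0 ≤ C) (hψ : 0 ≤ ψ)
    (hdψ : d ^ p ≤ C * ψ) (hτ : 0 ≤ τ) (hτ_le : τ ≤ N * (T * (d * u) + a))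
    (hu : u ^ 2 ≤ N ^ 2 * z ^ 2) (hb : b ^ 2 ≤ N ^ 2 * z' ^ 2) :
    α * d ^ (p - 2) * τ ^ 2 - C * (N ^ 2 * (α * (2 * N ^ 2) * T ^ 2 + h)) * ψ * (z ^ 2 + z' ^ 2) ≤
      η / 2 * d ^ (p - 2) * a ^ 2 - h * d ^ p * b ^ 2 := by
  have hτ₂ := sq_le_two_mul_of_le_add hτ hτ_le
  have e₁ : α * d ^ (p - 2) * τ ^ 2 ≤ η / 2 * d ^ (p - 2) * a ^ 2
      + α * (2 * N ^ 2) * T ^ 2 * d ^ p * u ^ 2 := by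
    calc α * d ^ (p - 2) * τ ^ 2
        ≤ α * d ^ (p - 2) * (2 * N ^ 2 * ((T * (d * u)) ^ 2 + a ^ 2)) := by gcongr
      _ = α * (2 * N ^ 2) * (d ^ (p - 2) * a ^ 2) + α * (2 * N ^ 2) * T ^ 2 * d ^ p * u ^ 2 := by
        rw [rpow_eq_mul_sq hd hp]
        ring
      _ ≤ η / 2 * (d ^ (p - 2) * a ^ 2) + α * (2 * N ^ 2) * T ^ 2 * d ^ p * u ^ 2 := by gcongr
      _ = _ := by ring
  have ht : 0 ≤ α * (2 * N ^ 2) * T ^ 2 := by positivity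
  generalize α * (2 * N ^ 2) * T ^ 2 = t at *
  have e₂ : t * d ^ p * u ^ 2 + h * d ^ p * b ^ 2
      ≤ C * (N ^ 2 * (t + h)) * ψ * (z ^ 2 + z' ^ 2) := by
    calc t * d ^ p * u ^ 2 + h * d ^ p * b ^ 2
        ≤ t * (C * ψ) * (N ^ 2 * z ^ 2) + h * (C * ψ) * (N ^ 2 * z' ^ 2) := by gcongr
      _ ≤ (t + h) * (C * ψ) * (N ^ 2 * z ^ 2) + (t + h) * (C * ψ) * (N ^ 2 * z' ^ 2) := by
        gcongr <;> linarith
      _ = _ := by ring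
  linarith

theorem mul_sq_le_of_le_add_far {lam Λ α N T τ u v z z' : ℝ} (hlam : 0 ≤ lam) (hΛ : lam ≤ Λ)
    (hα : 0 ≤ α) (hτ : 0 ≤ τ) (hτ_le : τ ≤ N * (T * u + v))
    (hu : u ^ 2 ≤ N ^ 2 * z ^ 2) (hv : v ^ 2 ≤ N ^ 2 * z' ^ 2) :
    α * lam * τ ^ 2 ≤
      α * Λ * (2 * N ^ 2 * (N ^ 2 * (T ^ 2 + 1))) * (z ^ 2 + z' ^ 2) := by
  have hτ₂ := sq_le_two_mul_of_le_add hτ hτ_le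
  have hΛ0 := hlam.trans hΛ
  calc α * lam * τ ^ 2 ≤ α * Λ * (2 * N ^ 2 * ((T * u) ^ 2 + v ^ 2)) := by gcongr
    _ ≤ α * Λ * (2 * N ^ 2 * (T ^ 2 * (N ^ 2 * z ^ 2) + 1 * (N ^ 2 * z' ^ 2))) := by
      rw [mul_pow, one_mul]
      gcongr
    _ ≤ α * Λ * (2 * N ^ 2 * ((T ^ 2 + 1) * (N ^ 2 * z ^ 2)
        + (T ^ 2 + 1) * (N ^ 2 * z' ^ 2))) := by
      gcongr
      · linarith
      · linarith [sq_nonneg T]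
    _ = _ := by ring

end RealInequalities

/-! ### Uniform constants and conclusion -/

section Main

variable {n : ℕ} {M : Type*} [MetricSpace M]
  [ChartedSpace (EuclideanSpace ℝ (Fin n)) M] [IsManifold (𝓡 n) ∞ M]
  [RiemannianBundle (fun x : M => TangentSpace (𝓡 n) x)]
  [IsContMDiffRiemannianBundle (𝓡 n) ∞ (EuclideanSpace ℝ (Fin n))
    (fun x : M => TangentSpace (𝓡 n) x)]
  {φ : OpenPartialHomeomorph M (EuclideanSpace ℝ (Fin n))} {K : Set M}

theorem exists_norm_comp_le_of_isCompact (hφ : φ ∈ IsManifold.maximalAtlas (𝓡 n) ∞ M)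
    (hK : K ⊆ φ.source) (hKc : IsCompact K) : ∃ C, 0 ≤ C ∧ ∀ x ∈ K,
      ∀ z : TangentSpace (𝓡 n) x, ‖comp φ x z‖ ≤ C * ‖z‖ ∧ ‖z‖ ≤ C * ‖comp φ x z‖ := by
  have := isContinuousRiemannianBundle (M := M) (n := n)
  obtain ⟨C, hC⟩ := exists_forall_of_isCompact hKc
    (P := fun C x => ∀ z : TangentSpace (𝓡 n) x,
      ‖comp φ x z‖ ≤ C * ‖z‖ ∧ ‖z‖ ≤ C * ‖comp φ x z‖)
    (fun x C C' hCC' h z => ⟨(h z).1.trans (mul_le_mul_of_nonneg_right hCC' (norm_nonneg _)),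
      (h z).2.trans (mul_le_mul_of_nonneg_right hCC' (norm_nonneg _))⟩)
    (fun x hx => (exists_norm_comp_le hφ (hK hx)).imp fun C h => h.2)
  exact ⟨max C 0, le_max_right _ _, fun x hx z =>
    ⟨(hC x hx z).1.trans (mul_le_mul_of_nonneg_right (le_max_left _ _) (norm_nonneg _)),
      (hC x hx z).2.trans (mul_le_mul_of_nonneg_right (le_max_left _ _) (norm_nonneg _))⟩⟩

theorem exists_norm_sub_le_dist_of_isCompact [IsRiemannianManifold (𝓡 n) M]
    (hφ : φ ∈ IsManifold.maximalAtlas (𝓡 n) ∞ M)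
    (hK : K ⊆ φ.source) (hKc : IsCompact K) : ∃ C, ∃ ε > 0, ∀ x ∈ K, ∀ x', dist x x' < ε →
      ‖φ x - φ x'‖ ≤ C * dist x x' := by
  have := isContinuousRiemannianBundle (M := M) (n := n)
  exact exists_pos_of_eventually_diagonal hKc
    (P := fun C q => ‖φ q.1 - φ q.2‖ ≤ C * dist q.1 q.2)
    (fun q C C' hCC' h => h.trans (mul_le_mul_of_nonneg_right hCC' dist_nonneg))
    (fun x hx => (exists_norm_sub_le_dist hφ (hK hx)).imp fun C h => h.2)

end Main

/-- The set OΔ may contain pairs far from the diagonal, so it is split at a distance ε; the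
hypothesis on the block is used only below ε. -/
theorem exists_le_hess_of_le_blockA {n : ℕ} {M : Type*} [MetricSpace M]
    [ChartedSpace (EuclideanSpace ℝ (Fin n)) M] [IsManifold (𝓡 n) ∞ M]
    [RiemannianBundle (fun x : M => TangentSpace (𝓡 n) x)]
    [IsContMDiffRiemannianBundle (𝓡 n) ∞ (EuclideanSpace ℝ (Fin n))
      (fun x : M => TangentSpace (𝓡 n) x)]
    [IsRiemannianManifold (𝓡 n) M]
    (cov : CovariantDerivative (𝓡 n) (EuclideanSpace ℝ (Fin n))
      (fun x : M => TangentSpace (𝓡 n) x))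
    [CovariantDerivative.ContMDiffCovariantDerivative cov ∞]
    (φ : OpenPartialHomeomorph M (EuclideanSpace ℝ (Fin n)))
    (hφ : φ ∈ IsManifold.maximalAtlas (𝓡 n) ∞ M)
    (O : Set M) (hOc : IsCompact (closure O)) (hOφ : closure O ⊆ φ.source)
    (G : M × M × ℝ → M) (hG : IsGeodesicMap cov φ (closure O) G)
    (Dom : Set M) (hDom : IsOpen Dom) (hDomc : IsCompact (closure Dom))
    (hDomO : closure Dom ⊆ O)
    (Ψ : M × M → ℝ) (W : Set (M × M)) (hW : IsOpen W) (hDomW : closure Dom ×ˢ closure Dom ⊆ W)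
    (hΨ : ContMDiffOn ((𝓡 n).prod (𝓡 n)) 𝓘(ℝ, ℝ) ∞ Ψ W)
    (hΨ_nonneg : ∀ x ∈ closure Dom, ∀ x' ∈ closure Dom, 0 ≤ Ψ (x, x'))
    (p : ℝ) (hp : 2 ≤ p)
    (hΨ_approx : ∃ C : ℝ, 0 < C ∧ ∀ x ∈ closure Dom, ∀ x' ∈ closure Dom,
      1 / C * dist x x' ^ p ≤ Ψ (x, x') ∧ Ψ (x, x') ≤ C * dist x x' ^ p)
    (OΔ : Set (M × M)) (hOΔ : OΔ ⊆ closure Dom ×ˢ closure Dom)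
    (η : ℝ) (hη : 0 < η)
    (hA : ∀ x x' : M, (x, x') ∈ OΔ → ∀ a : EuclideanSpace ℝ (Fin n),
      η * dist x x' ^ (p - 2) * ‖a‖ ^ 2 ≤ blockA cov φ Ψ x x' a) :
    ∃ α β : ℝ, 0 < α ∧ 0 < β ∧ ∀ x x' : M, (x, x') ∈ OΔ →
      ∀ (z : TangentSpace (𝓡 n) x) (z' : TangentSpace (𝓡 n) x'),
        α * dist x x' ^ (p - 2)
            * ‖parallelTransport cov φ (fun t => G (x, x', t)) x x' z - z'‖ ^ 2
          - β * Ψ (x, x') * (‖z‖ ^ 2 + ‖z'‖ ^ 2)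
          ≤ hess cov φ Ψ x x' z z' := by
  obtain ⟨C, hC, hCΨ⟩ := hΨ_approx
  have hDO : closure Dom ⊆ closure O := hDomO.trans subset_closure
  have hDφ : closure Dom ⊆ φ.source := hDO.trans hOφ
  obtain ⟨N, hN, hcomp⟩ := exists_norm_comp_le_of_isCompact hφ hDφ hDomc
  obtain ⟨S, ε₁, hε₁, hS⟩ := exists_norm_sub_le_dist_of_isCompact hφ hDφ hDomc
  obtain ⟨T₂, hT₂, hfar⟩ := hG.exists_norm_parallelTransport_le hφ hOφ hOc
  obtain ⟨T₁, ε₂, hε₂, hnear⟩ := hG.exists_norm_parallelTransport_sub_le hφ hOφ hOc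
  obtain ⟨H₁, ε₃, hε₃, hH₁⟩ := exists_le_hessCoord_near_diagonal (cov := cov) hφ hDom hDφ hDomc hW
    hDomW hΨ hp (C₀ := C) fun x hx x' hx' => by
      rw [abs_of_nonneg (hΨ_nonneg x hx x' hx')]
      exact (hCΨ x hx x' hx').2
  obtain ⟨H₂, hH₂0, hH₂⟩ := exists_abs_hessCoord_le (cov := cov) hφ hDφ hDomc hW hDomW hΨ
  obtain ⟨Λ, hΛ⟩ : ∃ Λ, ∀ x ∈ closure Dom, ∀ x' ∈ closure Dom, dist x x' ≤ Λ := by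
    obtain ⟨Λ, hΛ⟩ := Metric.isBounded_iff.1 hDomc.isBounded
    exact ⟨Λ, fun x hx x' hx' => hΛ hx hx'⟩
  set ε := min ε₁ (min ε₂ ε₃) with hε_def
  have hε : 0 < ε := lt_min hε₁ (lt_min hε₂ hε₃)
  -- Chosen so that 2 N² α ≤ η / 2; the added 1 covers N = 0.
  set α := η / (4 * (N ^ 2 + 1)) with hα_def
  have hα : 0 < α := by positivity
  have hαN : α * (2 * N ^ 2) ≤ η / 2 := by
    rw [hα_def, div_mul_eq_mul_div, div_le_div_iff₀ (by positivity) two_pos]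
    nlinarith
  -- Absolute values, because these constants come without a sign.
  set H := |H₁| with hH
  set T := |T₁| * |S| with hT
  set β₁ := C * (N ^ 2 * (α * (2 * N ^ 2) * T ^ 2 + (H ^ 2 / (2 * η) + H))) with hβ₁_def
  -- For any pair of points, R bounds the Hessian plus the α-term (the latter estimated with the
  -- crude transport bound) per unit of ‖z‖² + ‖z'‖². At distance at least ε, 1 ≤ (C / ε ^ p) Ψ
  -- converts R into β₂ Ψ.
  set R := H₂ * N ^ 2 + α * |Λ| ^ (p - 2) * (2 * N ^ 2 * (N ^ 2 * (T₂ ^ 2 + 1))) with hR_def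
  set β₂ := R * (C / ε ^ p) with hβ₂_def
  have hR : 0 ≤ R := by positivity
  have hβ₁ : 0 ≤ β₁ := by positivity
  have hβ₂ : 0 ≤ β₂ := by positivity
  -- β₁ serves near the diagonal and β₂ away from it; the 1 makes β positive.
  refine ⟨α, β₁ + β₂ + 1, hα, by positivity, fun x x' hxx' z z' => ?_⟩
  have hx := (hOΔ hxx').1
  have hx' := (hOΔ hxx').2
  simp only at hx hx'
  have hΨ0 := hΨ_nonneg x hx x' hx'
  have hz := (hcomp x hx z).1
  have hz' := (hcomp x' hx' z').1
  set d := dist x x' with hd_def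
  have hd : 0 ≤ d := dist_nonneg
  set τ := ‖parallelTransport cov φ (fun t => G (x, x', t)) x x' z - z'‖ with hτ_def
  have hτ : 0 ≤ τ := norm_nonneg _
  have hτ_le : τ ≤ N * ‖comp φ x' (parallelTransport cov φ (fun t => G (x, x', t)) x x' z)
      - comp φ x' z'‖ := by
    rw [← comp_sub]
    exact (hcomp x' hx' _).2
  have hlam : 0 ≤ d ^ (p - 2) := by positivity
  have hz2 : ‖comp φ x z‖ ^ 2 ≤ N ^ 2 * ‖z‖ ^ 2 := by
    rw [← mul_pow]
    gcongr
  have hz2' : ‖comp φ x' z'‖ ^ 2 ≤ N ^ 2 * ‖z'‖ ^ 2 := by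
    rw [← mul_pow]
    gcongr
  rcases lt_or_ge d ε with hdε | hdε
  · have hd₁ : d < ε₁ := hdε.trans_le (min_le_left _ _)
    have hd₂ : d < ε₂ := hdε.trans_le ((min_le_right _ _).trans (min_le_left _ _))
    have hd₃ : d < ε₃ := hdε.trans_le ((min_le_right _ _).trans (min_le_right _ _))
    set a := comp φ x z - comp φ x' z' with ha_def
    set b := comp φ x' z' with hb_def
    have hab : comp φ x z = a + b := by simp [ha_def]
    have hhess : η / 2 * d ^ (p - 2) * ‖a‖ ^ 2
        - (H ^ 2 / (2 * η) + H) * d ^ p * ‖b‖ ^ 2 ≤ hess cov φ Ψ x x' z z' := by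
      have h1 := hH₁ x hx x' hd₃ hx' a b
      have h2 := hA x x' hxx' a
      have h3 : H₁ * (d ^ (p - 1) * (‖a‖ * ‖b‖) + d ^ p * ‖b‖ ^ 2)
          ≤ H * (d ^ (p - 1) * (‖a‖ * ‖b‖) + d ^ p * ‖b‖ ^ 2) :=
        mul_le_mul_of_nonneg_right (le_abs_self _) (by positivity)
      have h4 := half_le_sub_of_mul (d := d) (H := H) (a := ‖a‖) (b := ‖b‖) hlam hη
      rw [← rpow_sub_one_eq_mul hd hp, ← rpow_eq_mul_sq hd hp] at h4
      unfold hess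
      rw [hab]
      linarith
    have hτ₁ : τ ≤ N * (T * (d * ‖comp φ x z‖) + ‖a‖) := by
      refine hτ_le.trans (mul_le_mul_of_nonneg_left ?_ hN)
      refine (norm_sub_le_norm_sub_add_norm_sub _ (comp φ x z) _).trans (add_le_add_left ?_ _)
      refine (hnear x (hDO hx) x' hd₂ (hDO hx') z).trans ?_
      have hs : ‖φ x - φ x'‖ ≤ |S| * d :=
        (hS x hx x' hd₁).trans (mul_le_mul_of_nonneg_right (le_abs_self _) hd)
      calc T₁ * ‖φ x - φ x'‖ * ‖comp φ x z‖
          ≤ |T₁| * (|S| * d) * ‖comp φ x z‖ := by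
            gcongr
            exact le_abs_self _
        _ = _ := by rw [hT]; ring
    have hΨp : d ^ p ≤ C * Ψ (x, x') := by
      have := (hCΨ x hx x' hx').1
      rwa [one_div, inv_mul_le_iff₀ hC] at this
    have e₁ := mul_sq_le_of_le_add_near hd hp hα.le hαN (h := H ^ 2 / (2 * η) + H)
      (by positivity) hC.le hΨ0 hΨp hτ hτ₁ hz2 hz2'
    have e₃ : 0 ≤ (β₂ + 1) * Ψ (x, x') * (‖z‖ ^ 2 + ‖z'‖ ^ 2) := by positivity
    linarith
  · have hτ₁ : τ ≤ N * (T₂ * ‖comp φ x z‖ + ‖comp φ x' z'‖) := by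
      refine hτ_le.trans (mul_le_mul_of_nonneg_left ?_ hN)
      exact (norm_sub_le _ _).trans (add_le_add_left (hfar x (hDO hx) x' (hDO hx') z) _)
    have hΨp : 1 ≤ C / ε ^ p * Ψ (x, x') := by
      have h1 : ε ^ p ≤ d ^ p := Real.rpow_le_rpow hε.le hdε (by linarith)
      have h2 := (hCΨ x hx x' hx').1
      rw [one_div, inv_mul_le_iff₀ hC] at h2
      rw [div_mul_eq_mul_div, one_le_div (by positivity)]
      exact h1.trans h2
    have e₁ := mul_sq_le_of_le_add_far hlam (Real.rpow_le_rpow hd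
      ((hΛ x hx x' hx').trans (le_abs_self _)) (by linarith)) hα.le hτ hτ₁ hz2 hz2'
    have e₂ : -(H₂ * N ^ 2 * (‖z‖ ^ 2 + ‖z'‖ ^ 2)) ≤ hess cov φ Ψ x x' z z' := by
      refine le_trans ?_ (abs_le.1 (hH₂ x hx x' hx' _ _)).1
      rw [neg_le_neg_iff, mul_assoc, mul_add (N ^ 2)]
      gcongr
    have e₃ : R * (‖z‖ ^ 2 + ‖z'‖ ^ 2) ≤ β₂ * Ψ (x, x') * (‖z‖ ^ 2 + ‖z'‖ ^ 2) := by
      refine mul_le_mul_of_nonneg_right ?_ (by positivity)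
      rw [hβ₂_def, mul_assoc]
      exact le_mul_of_one_le_right hR hΨp
    have e₄ : 0 ≤ (β₁ + 1) * Ψ (x, x') * (‖z‖ ^ 2 + ‖z'‖ ^ 2) := by positivity
    rw [hR_def, add_mul] at e₃
    linarith

end GeodesicHessian

end

theorem proposition2p2 {n : ℕ} {M : Type*} [MetricSpace M]
    [ChartedSpace (EuclideanSpace ℝ (Fin n)) M] [IsManifold (𝓡 n) ∞ M]
    -- `M` is a complete Riemannian manifold, `dist` is its Riemannian distance
    [RiemannianBundle (fun x : M => TangentSpace (𝓡 n) x)]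
    [IsContMDiffRiemannianBundle (𝓡 n) ∞ (EuclideanSpace ℝ (Fin n))
      (fun x : M => TangentSpace (𝓡 n) x)]
    [IsRiemannianManifold (𝓡 n) M] [CompleteSpace M]
    -- a smooth torsion-free connection, unrelated to the metric
    (cov : CovariantDerivative (𝓡 n) (EuclideanSpace ℝ (Fin n))
      (fun x : M => TangentSpace (𝓡 n) x))
    [CovariantDerivative.ContMDiffCovariantDerivative cov ∞]
    (hcov : cov.torsion = 0)
    -- `O` is open and relatively compact in the domain of a chart
    (φ : OpenPartialHomeomorph M (EuclideanSpace ℝ (Fin n)))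
    (hφ : φ ∈ IsManifold.maximalAtlas (𝓡 n) ∞ M)
    (O : Set M) (hO : IsOpen O) (hOc : IsCompact (closure O)) (hOφ : closure O ⊆ φ.source)
    -- unique geodesics in the closure of `O`, depending smoothly on their endpoints
    (G : M × M × ℝ → M) (hG : GeodesicHessian.IsGeodesicMap cov φ (closure O) G)
    -- `Dom` is open, nonempty, relatively compact in `O`; its closure is a sublevel set of `χ`
    (Dom : Set M) (hDom : IsOpen Dom) (hDom_ne : Dom.Nonempty) (hDomc : IsCompact (closure Dom))
    (hDomO : closure Dom ⊆ O)
    (χ : M → ℝ) (c : ℝ) (hχ : ContMDiffOn (𝓡 n) 𝓘(ℝ, ℝ) ∞ χ O)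
    (hχ_conv : GeodesicHessian.IsGeodesicallyConvexOn cov φ O χ)
    (hχDom : closure Dom = {x ∈ O | χ x ≤ c})
    -- `Ψ` is smooth and convex on an open set containing the product of `closure Dom` with itself
    (Ψ : M × M → ℝ) (W : Set (M × M)) (hW : IsOpen W) (hDomW : closure Dom ×ˢ closure Dom ⊆ W)
    (hWO : W ⊆ O ×ˢ O)
    (hΨ : ContMDiffOn ((𝓡 n).prod (𝓡 n)) 𝓘(ℝ, ℝ) ∞ Ψ W)
    (hΨ_conv : GeodesicHessian.IsProdGeodesicallyConvexOn cov φ W Ψ)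
    -- `Ψ` is nonnegative, vanishes only on the diagonal, and is comparable to `dist ^ p`
    (hΨ_nonneg : ∀ x ∈ closure Dom, ∀ x' ∈ closure Dom, 0 ≤ Ψ (x, x'))
    (hΨ_zero : ∀ x ∈ closure Dom, ∀ x' ∈ closure Dom, (Ψ (x, x') = 0 ↔ x = x'))
    (p : ℝ) (hp : 2 ≤ p)
    (hΨ_approx : ∃ C : ℝ, 0 < C ∧ ∀ x ∈ closure Dom, ∀ x' ∈ closure Dom,
      1 / C * dist x x' ^ p ≤ Ψ (x, x') ∧ Ψ (x, x') ≤ C * dist x x' ^ p)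
    -- a neighbourhood of the diagonal, relative to the product of `closure Dom` with itself
    (OΔ : Set (M × M)) (hOΔ : OΔ ⊆ closure Dom ×ˢ closure Dom)
    (hOΔ_nhds : ∀ x ∈ closure Dom, OΔ ∈ 𝓝[closure Dom ×ˢ closure Dom] (x, x))
    (η : ℝ) (hη : 0 < η)
    (hA : ∀ x x' : M, (x, x') ∈ OΔ → ∀ a : EuclideanSpace ℝ (Fin n),
      η * dist x x' ^ (p - 2) * ‖a‖ ^ 2 ≤ GeodesicHessian.blockA cov φ Ψ x x' a) :
    ∃ α β : ℝ, 0 < α ∧ 0 < β ∧ ∀ x x' : M, (x, x') ∈ OΔ →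
      ∀ (z : TangentSpace (𝓡 n) x) (z' : TangentSpace (𝓡 n) x'),
        α * dist x x' ^ (p - 2)
            * ‖GeodesicHessian.parallelTransport cov φ (fun t => G (x, x', t)) x x' z - z'‖ ^ 2
          - β * Ψ (x, x') * (‖z‖ ^ 2 + ‖z'‖ ^ 2)
          ≤ GeodesicHessian.hess cov φ Ψ x x' z z' := 
  GeodesicHessian.exists_le_hess_of_le_blockA cov φ hφ O hOc hOφ G hG Dom hDom hDomc hDomO Ψ W hW
    hDomW hΨ hΨ_nonneg p hp hΨ_approx OΔ hOΔ η hη hA
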